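/- Let \(k\) be a field, let \(U, H\) be Hopf algebras over \(k\) with bijective antipodes, and let \(R : H\otimes U\to U\otimes H\) be a linear map, written \(R(h\otimes u)=u^R\otimes h^R\) (with further letters for further applications of \(R\)). Assume that \(R\) is * normal: \(R(h\otimes 1)=1\otimes h\) and \(R(1\otimes u)=u\otimes 1\); * multiplicative: \(u^R\otimes (hh')^R=(u^R)^r\otimes h^r h'^R\) and \((uu')^R\otimes h^R=u^R u'^r\otimes (h^R)^r\); * a coalgebra map. Let \(U\#_R H\) be the Hopf algebra on the tensor product coalgebra \(U\otimes H\) with product \((u\# h)(u'\# h')=uu'^R\# h^Rh'\) and antipode \(S(u\# h)=S(u)^R\# S(h)^R\). A partial representation of a Hopf algebra \(A\) on a \(k\)-algebra \(B\) is a linear map \(\pi:A\to B\) with \(\pi(1)=1\), \(\pi(h)\pi(a_{(1)})\pi(S(a_{(2)}))=\pi(ha_{(1)})\pi(S(a_{(2)}))\) and \(\pi(a_{(1)})\pi(S(a_{(2)}))\pi(h)=\pi(a_{(1)})\pi(S(a_{(2)})h)\) for all \(a,h\in A\). Let \(A_{par}\) be the quotient of the tensor algebra \(T(A)\) by the relations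 \(1_A=1_{T(A)}\), \(h\otimes a_{(1)}\otimes S(a_{(2)})=ha_{(1)}\otimes S(a_{(2)})\) and \(a_{(1)}\otimes S(a_{(2)})\otimes h=a_{(1)}\otimes S(a_{(2)})h\), and write \([a]\) for the class of \(a\in A\). Then there is a well-defined linear map \(\mathcal R: H_{par}\otimes U_{par}\to U_{par}\otimes H_{par}\) such that \[\mathcal R([h_1]\cdots[h_n]\otimes[u_1]\cdots[u_m])=[u_1^{R_{11}\cdots R_{1n}}]\cdots[u_m^{R_{m1}\cdots R_{mn}}]\otimes[h_1^{R_{1n}\cdots R_{mn}}]\cdots[h_n^{R_{11}\cdots R_{m1}}],\] it is normal and multiplicative (so that \(U_{par}\#_{\mathcal R}H_{par}\), with product \((x\# y)(x'\# y')=xx'^{\mathcal R}\# y^{\mathcal R}y'\), is an associative unital algebra), and there are isomorphisms of categories \[\mathcal P^R_{U,H}\;\cong\;\mathsf{PRep}^{\mathrm{split}}_{U\#_RH}\;\cong\;\mathsf{Rep}_{U_{par}\#_{\mathcal R}H_{par}},\] which commute with the functors to \(k\)-algebras sending an object to its target algebra \(B\). Here, with \(B\) ranging over all \(k\)-algebras,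 * \(\mathcal P^R_{U,H}\) has as objects the pairs of partial representations \((\alpha:U\to B,\ \eta:H\to B)\) with \(\eta(h)\alpha(u)=\alpha(u^R)\eta(h^R)\) for all \(u\in U,h\in H\), and as morphisms the algebra maps \(f:B\to B'\) with \(f\circ\alpha=\alpha'\), \(f\circ\eta=\eta'\); * \(\mathsf{PRep}^{\mathrm{split}}_{U\#_RH}\) has as objects the partial representations \(\pi:U\#_RH\to B\) with \(\pi(u\# h)=\pi(u\# 1)\pi(1\# h)\) and \(\pi(u^R\# h^R)=\pi(1\# h)\pi(u\# 1)\) for all \(u\in U,h\in H\), and as morphisms the algebra maps \(f:B\to B'\) with \(f\circ\pi=\pi'\); * \(\mathsf{Rep}_A\), for an algebra \(A\), has as objects the algebra maps \(\sigma:A\to B\) and as morphisms the algebra maps \(f:B\to B'\) with \(f\circ\sigma=\sigma'\). -/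

import Mathlib

set_option linter.unusedSectionVars false

open TensorProduct CategoryTheory

universe w

namespace PartialHopf

section Smash

variable {k : Type*} [Field k]
  {U : Type*} [Ring U] [Algebra k U] {H : Type*} [Ring H] [Algebra k H]

/-- Left and right normality of `R : H ⊗ U → U ⊗ H`:
`R (h ⊗ 1) = 1 ⊗ h` and `R (1 ⊗ u) = u ⊗ 1`. -/
class IsNormal (R : H ⊗[k] U →ₗ[k] U ⊗[k] H) : Prop where
  left (h : H) : R (h ⊗ₜ[k] (1 : U)) = (1 : U) ⊗ₜ[k] h
  right (u : U) : R ((1 : H) ⊗ₜ[k] u) = u ⊗ₜ[k] (1 : H)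

/-- Left and right multiplicativity of `R : H ⊗ U → U ⊗ H`.  In the notation
`R (h ⊗ u) = u^R ⊗ h^R` these say
`u^R ⊗ (h h')^R = (u^R)^r ⊗ h^r h'^R` and `(u u')^R ⊗ h^R = u^R u'^r ⊗ (h^R)^r`. -/
class IsMultiplicative (R : H ⊗[k] U →ₗ[k] U ⊗[k] H) : Prop where
  left : R ∘ₗ (LinearMap.mul' k H).rTensor U =
    (LinearMap.mul' k H).lTensor U ∘ₗ (TensorProduct.assoc k U H H).toLinearMap ∘ₗ
      R.rTensor H ∘ₗ (TensorProduct.assoc k H U H).symm.toLinearMap ∘ₗ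
      R.lTensor H ∘ₗ (TensorProduct.assoc k H H U).toLinearMap
  right : R ∘ₗ (LinearMap.mul' k U).lTensor H =
    (LinearMap.mul' k U).rTensor H ∘ₗ (TensorProduct.assoc k U U H).symm.toLinearMap ∘ₗ
      R.lTensor U ∘ₗ (TensorProduct.assoc k U H U).toLinearMap ∘ₗ
      R.rTensor U ∘ₗ (TensorProduct.assoc k H U U).symm.toLinearMap

/-- The vector space `U ⊗ H`, to be endowed with the multiplication twisted by `R`. -/
def Smash (_R : H ⊗[k] U →ₗ[k] U ⊗[k] H) : Type _ := U ⊗[k] H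

/-- The multiplication `(u # h) (u' # h') = u u'^R # h^R h'` as a linear map. -/
noncomputable def smashMul (R : H ⊗[k] U →ₗ[k] U ⊗[k] H) :
    (U ⊗[k] H) ⊗[k] (U ⊗[k] H) →ₗ[k] U ⊗[k] H :=
  TensorProduct.map (LinearMap.mul' k U) (LinearMap.mul' k H) ∘ₗ
    (TensorProduct.assoc k U U (H ⊗[k] H)).symm.toLinearMap ∘ₗ
    ((TensorProduct.assoc k U H H).toLinearMap ∘ₗ R.rTensor H ∘ₗ
      (TensorProduct.assoc k H U H).symm.toLinearMap).lTensor U ∘ₗ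
    (TensorProduct.assoc k U H (U ⊗[k] H)).toLinearMap

theorem smashMul_tmul (R : H ⊗[k] U →ₗ[k] U ⊗[k] H) (u u' : U) (h h' : H) :
    smashMul R ((u ⊗ₜ h) ⊗ₜ (u' ⊗ₜ h')) =
      TensorProduct.map (LinearMap.mulLeft k u) (LinearMap.mulRight k h') (R (h ⊗ₜ u')) := by
  simp only [smashMul, LinearMap.comp_apply, LinearEquiv.coe_coe, TensorProduct.assoc_tmul,
    LinearMap.lTensor_tmul, TensorProduct.assoc_symm_tmul, LinearMap.rTensor_tmul]
  induction R (h ⊗ₜ u') with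
  | zero => simp
  | tmul a b => simp
  | add x y hx hy => simp only [add_tmul, tmul_add, map_add, hx, hy]

theorem R_mul_left (R : H ⊗[k] U →ₗ[k] U ⊗[k] H) [IsMultiplicative R] (h h' : H) (u : U) :
    R ((h * h') ⊗ₜ u) = (LinearMap.mul' k H).lTensor U (TensorProduct.assoc k U H H
      (R.rTensor H ((TensorProduct.assoc k H U H).symm (h ⊗ₜ R (h' ⊗ₜ u))))) := by
  simpa using LinearMap.congr_fun (IsMultiplicative.left (R := R)) ((h ⊗ₜ h') ⊗ₜ u)

theorem R_mul_right (R : H ⊗[k] U →ₗ[k] U ⊗[k] H) [IsMultiplicative R] (h : H) (u u' : U) :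
    R (h ⊗ₜ (u * u')) = (LinearMap.mul' k U).rTensor H ((TensorProduct.assoc k U U H).symm
      (R.lTensor U (TensorProduct.assoc k U H U (R (h ⊗ₜ u) ⊗ₜ u')))) := by
  simpa using LinearMap.congr_fun (IsMultiplicative.right (R := R)) (h ⊗ₜ (u ⊗ₜ u'))

theorem smashMul_assoc (R : H ⊗[k] U →ₗ[k] U ⊗[k] H) [IsMultiplicative R] (x y z : U ⊗[k] H) :
    smashMul R (smashMul R (x ⊗ₜ y) ⊗ₜ z) = smashMul R (x ⊗ₜ smashMul R (y ⊗ₜ z)) := by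
  induction x with
  | zero => simp
  | add x x' hx hx' => simp only [add_tmul, map_add, hx, hx']
  | tmul u h =>
  induction y with
  | zero => simp
  | add x x' hx hx' => simp only [add_tmul, tmul_add, map_add, hx, hx']
  | tmul u' h' =>
  induction z with
  | zero => simp
  | add x x' hx hx' => simp only [tmul_add, map_add, hx, hx']
  | tmul u'' h'' =>
  have e1 : ∀ X : U ⊗[k] H, ∀ Y : U ⊗[k] H, Y = R (h' ⊗ₜ u'') →
      smashMul R (TensorProduct.map (LinearMap.mulLeft k u) (LinearMap.mulRight k h') X ⊗ₜ
        (u'' ⊗ₜ h'')) = TensorProduct.map (LinearMap.mulLeft k u) (LinearMap.mulRight k h'')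
          (smashMul R (X ⊗ₜ Y)) := by
    intro X Y hY
    induction X with
    | zero => simp
    | add x x' hx hx' => simp only [add_tmul, map_add, hx, hx']
    | tmul a b =>
      simp only [map_tmul, LinearMap.mulLeft_apply, LinearMap.mulRight_apply, smashMul_tmul,
        R_mul_left, ← hY]
      clear hY
      induction Y with
      | zero => simp
      | add x x' hx hx' => simp only [tmul_add, map_add, hx, hx']
      | tmul c d =>
        simp only [smashMul_tmul, TensorProduct.assoc_symm_tmul, LinearMap.rTensor_tmul]
        induction R (b ⊗ₜ c) with
        | zero => simp
        | add x x' hx hx' => simp only [add_tmul, map_add, hx, hx']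
        | tmul p q => simp [mul_assoc]
  have e2 : ∀ X : U ⊗[k] H, ∀ Y : U ⊗[k] H, X = R (h ⊗ₜ u') →
      smashMul R ((u ⊗ₜ h) ⊗ₜ
        TensorProduct.map (LinearMap.mulLeft k u') (LinearMap.mulRight k h'') Y) =
        TensorProduct.map (LinearMap.mulLeft k u) (LinearMap.mulRight k h'')
          (smashMul R (X ⊗ₜ Y)) := by
    intro X Y hX
    induction Y with
    | zero => simp
    | add x x' hx hx' => simp only [tmul_add, map_add, hx, hx']
    | tmul a b =>
      simp only [map_tmul, LinearMap.mulLeft_apply, LinearMap.mulRight_apply, smashMul_tmul,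
        R_mul_right, ← hX]
      clear hX
      induction X with
      | zero => simp
      | add x x' hx hx' => simp only [add_tmul, map_add, hx, hx']
      | tmul c d =>
        simp only [smashMul_tmul, TensorProduct.assoc_tmul, LinearMap.lTensor_tmul]
        induction R (d ⊗ₜ a) with
        | zero => simp
        | add x x' hx hx' => simp only [tmul_add, map_add, hx, hx']
        | tmul p q => simp [mul_assoc]
  rw [smashMul_tmul, smashMul_tmul, e1 _ _ rfl, e2 _ _ rfl]

theorem smashMul_one_left (R : H ⊗[k] U →ₗ[k] U ⊗[k] H) [IsNormal R] (x : U ⊗[k] H) :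
    smashMul R ((1 ⊗ₜ 1) ⊗ₜ x) = x := by
  induction x with
  | zero => simp
  | add x x' hx hx' => simp only [tmul_add, map_add, hx, hx']
  | tmul u h => simp [smashMul_tmul, IsNormal.right]

theorem smashMul_one_right (R : H ⊗[k] U →ₗ[k] U ⊗[k] H) [IsNormal R] (x : U ⊗[k] H) :
    smashMul R (x ⊗ₜ (1 ⊗ₜ 1)) = x := by
  induction x with
  | zero => simp
  | add x x' hx hx' => simp only [add_tmul, map_add, hx, hx']
  | tmul u h => simp [smashMul_tmul, IsNormal.left]

variable (R : H ⊗[k] U →ₗ[k] U ⊗[k] H)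

noncomputable instance : AddCommGroup (Smash R) := inferInstanceAs (AddCommGroup (U ⊗[k] H))

noncomputable instance : Module k (Smash R) := inferInstanceAs (Module k (U ⊗[k] H))

/-- The identification of the vector spaces `U ⊗ H` and `U #_R H`. -/
noncomputable def Smash.of : U ⊗[k] H ≃ₗ[k] Smash R := LinearEquiv.refl k (U ⊗[k] H)

/-- The element `u #_R h`. -/
noncomputable def Smash.mk (u : U) (h : H) : Smash R := Smash.of R (u ⊗ₜ[k] h)

noncomputable instance : One (Smash R) := ⟨Smash.mk R 1 1⟩

noncomputable instance : Mul (Smash R) :=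
  ⟨fun x y => Smash.of R (smashMul R ((Smash.of R).symm x ⊗ₜ[k] (Smash.of R).symm y))⟩

theorem Smash.one_def : (1 : Smash R) = Smash.of R (1 ⊗ₜ 1) := rfl

theorem Smash.mul_def (x y : Smash R) :
    x * y = Smash.of R (smashMul R ((Smash.of R).symm x ⊗ₜ[k] (Smash.of R).symm y)) := rfl

theorem Smash.mk_mul_mk (u u' : U) (h h' : H) :
    Smash.mk R u h * Smash.mk R u' h' = Smash.of R
      (TensorProduct.map (LinearMap.mulLeft k u) (LinearMap.mulRight k h') (R (h ⊗ₜ u'))) := by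
  rw [Smash.mul_def, Smash.mk, Smash.mk, LinearEquiv.symm_apply_apply,
    LinearEquiv.symm_apply_apply, smashMul_tmul]

variable [IsNormal R] [IsMultiplicative R]

/-- The smash product `U #_R H` is a ring when `R` is normal and multiplicative. -/
noncomputable instance : Ring (Smash R) :=
  { (inferInstance : AddCommGroup (Smash R)) with
    one := 1
    mul := (· * ·)
    mul_assoc := fun x y z => by simp [Smash.mul_def, smashMul_assoc]
    one_mul := fun x => by simp [Smash.mul_def, Smash.one_def, smashMul_one_left]
    mul_one := fun x => by simp [Smash.mul_def, Smash.one_def, smashMul_one_right]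
    left_distrib := fun x y z => by simp [Smash.mul_def, tmul_add]
    right_distrib := fun x y z => by simp [Smash.mul_def, add_tmul]
    zero_mul := fun x => by simp [Smash.mul_def]
    mul_zero := fun x => by simp [Smash.mul_def] }

noncomputable instance : Algebra k (Smash R) :=
  Algebra.ofModule (fun r x y => by
      rw [Smash.mul_def, Smash.mul_def, map_smul, ← smul_tmul', map_smul, map_smul])
    (fun r x y => by simp [Smash.mul_def])

end Smash


section SmashHopf

open Coalgebra HopfAlgebra

/-- `R : H ⊗ U → U ⊗ H` is a morphism of coalgebras. -/
class IsCoalgMap {k : Type*} [Field k] {U : Type*} [AddCommGroup U] [Module k U] [Coalgebra k U]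
    {H : Type*} [AddCommGroup H] [Module k H] [Coalgebra k H]
    (R : H ⊗[k] U →ₗ[k] U ⊗[k] H) : Prop where
  counit_comp : counit ∘ₗ R = counit
  map_comp_comul : TensorProduct.map R R ∘ₗ comul = comul ∘ₗ R

variable {k : Type*} [Field k]
  {U : Type*} [Ring U] [HopfAlgebra k U] {H : Type*} [Ring H] [HopfAlgebra k H]
  (R : H ⊗[k] U →ₗ[k] U ⊗[k] H)

/-- `R` as a bundled coalgebra morphism. -/
noncomputable def toCoalgHom [IsCoalgMap R] : H ⊗[k] U →ₗc[k] U ⊗[k] H :=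
  { R with
    counit_comp := IsCoalgMap.counit_comp
    map_comp_comul := IsCoalgMap.map_comp_comul }

/-- The twisted multiplication as a coalgebra morphism. -/
noncomputable def smashMulCoalgHom [IsCoalgMap R] :
    (U ⊗[k] H) ⊗[k] (U ⊗[k] H) →ₗc[k] U ⊗[k] H :=
  (Coalgebra.TensorProduct.map (Bialgebra.mulCoalgHom k U) (Bialgebra.mulCoalgHom k H)).comp <|
  (Coalgebra.TensorProduct.assoc k k U U (H ⊗[k] H)).symm.toCoalgHom.comp <|
  (Coalgebra.TensorProduct.map (CoalgHom.id k U)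
    ((Coalgebra.TensorProduct.assoc k k U H H).toCoalgHom.comp <|
      (Coalgebra.TensorProduct.map (toCoalgHom R) (CoalgHom.id k H)).comp <|
      (Coalgebra.TensorProduct.assoc k k H U H).symm.toCoalgHom)).comp <|
  (Coalgebra.TensorProduct.assoc k k U H (U ⊗[k] H)).toCoalgHom

theorem smashMulCoalgHom_apply [IsCoalgMap R] (x : (U ⊗[k] H) ⊗[k] (U ⊗[k] H)) :
    smashMulCoalgHom R x = smashMul R x := rfl

noncomputable instance : Coalgebra k (Smash R) := inferInstanceAs (Coalgebra k (U ⊗[k] H))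

theorem Smash.counit_of (x : U ⊗[k] H) : counit (R := k) (Smash.of R x) = counit (R := k) x := rfl

theorem Smash.comul_of (x : U ⊗[k] H) :
    comul (R := k) (Smash.of R x) =
      TensorProduct.map (Smash.of R).toLinearMap (Smash.of R).toLinearMap (comul (R := k) x) := by
  change comul (R := k) x = _
  have : TensorProduct.map (Smash.of R).toLinearMap (Smash.of R).toLinearMap =
    (LinearMap.id : (U ⊗[k] H) ⊗[k] (U ⊗[k] H) →ₗ[k] _) := TensorProduct.map_id
  exact (LinearMap.congr_fun this _).symm

variable [IsNormal R] [IsMultiplicative R] [IsCoalgMap R]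

/-- The `R`-smash product of Hopf algebras, with the tensor product coalgebra structure, is a
bialgebra. -/
noncomputable instance : Bialgebra k (Smash R) :=
  Bialgebra.mk' k (Smash R)
    (by rw [Smash.one_def, Smash.counit_of]; simp)
    (by
      intro a b
      obtain ⟨a, rfl⟩ := (Smash.of R).surjective a
      obtain ⟨b, rfl⟩ := (Smash.of R).surjective b
      rw [Smash.mul_def, Smash.counit_of, Smash.counit_of, Smash.counit_of,
        ← smashMulCoalgHom_apply, CoalgHomClass.counit_comp_apply]
      simp [mul_comm])
    (by rw [Smash.one_def, Smash.comul_of]; simp [Algebra.TensorProduct.one_def]; rfl)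
    (by
      intro a b
      obtain ⟨a, rfl⟩ := (Smash.of R).surjective a
      obtain ⟨b, rfl⟩ := (Smash.of R).surjective b
      rw [Smash.mul_def, Smash.comul_of, Smash.comul_of, Smash.comul_of,
        ← smashMulCoalgHom_apply, ← CoalgHomClass.map_comp_comul_apply]
      simp only [LinearEquiv.symm_apply_apply, TensorProduct.comul_tmul]
      generalize comul (R := k) a = x
      generalize comul (R := k) b = y
      induction x with
      | zero => simp
      | add x x' hx hx' => simp only [add_tmul, map_add, hx, hx', add_mul]
      | tmul p q =>
      induction y with
      | zero => simp
      | add x x' hx hx' => simp only [tmul_add, map_add, hx, hx', mul_add]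
      | tmul r s => simp [Smash.mul_def, smashMulCoalgHom_apply])

/-- `S (u # h) = R (S h ⊗ S u)`. -/
noncomputable def smashAntipode : Smash R →ₗ[k] Smash R :=
  (Smash.of R).toLinearMap ∘ₗ R ∘ₗ TensorProduct.map (antipode k) (antipode k) ∘ₗ
    (TensorProduct.comm k U H).toLinearMap ∘ₗ (Smash.of R).symm.toLinearMap

/-- The inclusion `u ↦ u # 1` as an algebra map. -/
noncomputable def Smash.inclLeft : U →ₐ[k] Smash R :=
  AlgHom.ofLinearMap ((Smash.of R).toLinearMap ∘ₗ (TensorProduct.mk k U H).flip 1) rfl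
    (fun u u' => by
      change _ = Smash.mk R u 1 * Smash.mk R u' 1
      rw [Smash.mk_mul_mk, IsNormal.right]
      simp)

/-- The inclusion `h ↦ 1 # h` as an algebra map. -/
noncomputable def Smash.inclRight : H →ₐ[k] Smash R :=
  AlgHom.ofLinearMap ((Smash.of R).toLinearMap ∘ₗ TensorProduct.mk k U H 1) rfl
    (fun h h' => by
      change _ = Smash.mk R 1 h * Smash.mk R 1 h'
      rw [Smash.mk_mul_mk, IsNormal.left]
      simp)

theorem Smash.inclLeft_mul_inclRight (u : U) (h : H) :
    Smash.inclLeft R u * Smash.inclRight R h = Smash.of R (u ⊗ₜ h) := by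
  change Smash.mk R u 1 * Smash.mk R 1 h = _
  rw [Smash.mk_mul_mk, IsNormal.right]
  simp

theorem Smash.inclRight_mul_inclLeft (u : U) (h : H) :
    Smash.inclRight R h * Smash.inclLeft R u = Smash.of R (R (h ⊗ₜ u)) := by
  change Smash.mk R 1 h * Smash.mk R u 1 = _
  rw [Smash.mk_mul_mk]
  simp

theorem smashAntipode_of (u : U) (h : H) :
    smashAntipode R (Smash.of R (u ⊗ₜ h)) =
      Smash.inclRight R (antipode k h) * Smash.inclLeft R (antipode k u) := by
  rw [Smash.inclRight_mul_inclLeft]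
  simp [smashAntipode]

theorem smashAntipode_incl (u : U) (h : H) :
    smashAntipode R (Smash.inclLeft R u * Smash.inclRight R h) =
      Smash.inclRight R (antipode k h) * Smash.inclLeft R (antipode k u) := by
  rw [Smash.inclLeft_mul_inclRight, smashAntipode_of]

theorem smashAntipode_mul_id :
    LinearMap.mul' k (Smash R) ∘ₗ (smashAntipode R).rTensor (Smash R) ∘ₗ comul =
      Algebra.linearMap k (Smash R) ∘ₗ counit := by
  refine LinearMap.ext fun a => ?_
  obtain ⟨a, rfl⟩ := (Smash.of R).surjective a
  induction a with
  | zero => simp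
  | add x y hx hy => simp only [map_add, hx, hy]
  | tmul u h =>
  have key : ∀ (x : U ⊗[k] U) (y : H ⊗[k] H),
      LinearMap.mul' k (Smash R) ((smashAntipode R).rTensor (Smash R)
        (TensorProduct.map (Smash.of R).toLinearMap (Smash.of R).toLinearMap
          (TensorProduct.AlgebraTensorModule.tensorTensorTensorComm k k k k U U H H
            (x ⊗ₜ y)))) =
      LinearMap.mul' k (Smash R) (TensorProduct.map
        (LinearMap.mulRight k (Smash.inclLeft R
          (LinearMap.mul' k U ((antipode k).rTensor U x))) ∘ₗ
          (Smash.inclRight R).toLinearMap ∘ₗ antipode k)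
        (Smash.inclRight R).toLinearMap y) := by
    intro x y
    induction y with
    | zero => simp
    | add y y' hy hy' => simp only [tmul_add, map_add, hy, hy']
    | tmul c d =>
    induction x with
    | zero => simp
    | add x x' hx hx' =>
      simp only [add_tmul, map_add, hx, hx', map_tmul, LinearMap.comp_apply,
        LinearMap.mulRight_apply, mul_add, LinearMap.mul'_apply]
    | tmul a b =>
      simp [smashAntipode_incl, ← Smash.inclLeft_mul_inclRight, mul_assoc]
  have key2 : ∀ y : H ⊗[k] H,
      LinearMap.mul' k (Smash R) (TensorProduct.map
        ((Smash.inclRight R).toLinearMap ∘ₗ antipode k) (Smash.inclRight R).toLinearMap y) =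
      Smash.inclRight R (LinearMap.mul' k H ((antipode k).rTensor H y)) := by
    intro y
    induction y with
    | zero => simp
    | add y y' hy hy' => simp only [map_add, hy, hy']
    | tmul c d => simp
  have hr : LinearMap.mulRight k (algebraMap k (Smash R) (counit u)) =
      (counit (R := k) u) • LinearMap.id := by
    ext z
    simp [Algebra.algebraMap_eq_smul_one]
  simp only [LinearMap.comp_apply, Smash.comul_of, Smash.counit_of, TensorProduct.comul_tmul]
  rw [key, mul_antipode_rTensor_comul_apply, AlgHom.commutes, hr, LinearMap.smul_comp,
    LinearMap.id_comp, TensorProduct.map_smul_left, LinearMap.smul_apply, map_smul, key2,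
    mul_antipode_rTensor_comul_apply, AlgHom.commutes]
  simp [Algebra.algebraMap_eq_smul_one, smul_smul, mul_comm]

theorem id_mul_smashAntipode :
    LinearMap.mul' k (Smash R) ∘ₗ (smashAntipode R).lTensor (Smash R) ∘ₗ comul =
      Algebra.linearMap k (Smash R) ∘ₗ counit := by
  refine LinearMap.ext fun a => ?_
  obtain ⟨a, rfl⟩ := (Smash.of R).surjective a
  induction a with
  | zero => simp
  | add x y hx hy => simp only [map_add, hx, hy]
  | tmul u h =>
  have key : ∀ (x : U ⊗[k] U) (y : H ⊗[k] H),
      LinearMap.mul' k (Smash R) ((smashAntipode R).lTensor (Smash R)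
        (TensorProduct.map (Smash.of R).toLinearMap (Smash.of R).toLinearMap
          (TensorProduct.AlgebraTensorModule.tensorTensorTensorComm k k k k U U H H
            (x ⊗ₜ y)))) =
      LinearMap.mul' k (Smash R) (TensorProduct.map
        (LinearMap.mulRight k (Smash.inclRight R
          (LinearMap.mul' k H ((antipode k).lTensor H y))) ∘ₗ
          (Smash.inclLeft R).toLinearMap)
        ((Smash.inclLeft R).toLinearMap ∘ₗ antipode k) x) := by
    intro x y
    induction x with
    | zero => simp
    | add x x' hx hx' => simp only [add_tmul, map_add, hx, hx']
    | tmul a b =>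
    induction y with
    | zero => simp
    | add y y' hy hy' =>
      simp only [tmul_add, map_add, hy, hy', map_tmul, LinearMap.comp_apply,
        LinearMap.mulRight_apply, mul_add, add_mul, LinearMap.mul'_apply]
    | tmul c d =>
      simp [smashAntipode_incl, ← Smash.inclLeft_mul_inclRight, mul_assoc]
  have key2 : ∀ x : U ⊗[k] U,
      LinearMap.mul' k (Smash R) (TensorProduct.map
        (Smash.inclLeft R).toLinearMap ((Smash.inclLeft R).toLinearMap ∘ₗ antipode k) x) =
      Smash.inclLeft R (LinearMap.mul' k U ((antipode k).lTensor U x)) := by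
    intro x
    induction x with
    | zero => simp
    | add y y' hy hy' => simp only [map_add, hy, hy']
    | tmul c d => simp
  have hr : LinearMap.mulRight k (algebraMap k (Smash R) (counit h)) =
      (counit (R := k) h) • LinearMap.id := by
    ext z
    simp [Algebra.algebraMap_eq_smul_one]
  simp only [LinearMap.comp_apply, Smash.comul_of, Smash.counit_of, TensorProduct.comul_tmul]
  rw [key, mul_antipode_lTensor_comul_apply, AlgHom.commutes, hr, LinearMap.smul_comp,
    LinearMap.id_comp, TensorProduct.map_smul_left, LinearMap.smul_apply, map_smul, key2,
    mul_antipode_lTensor_comul_apply, AlgHom.commutes]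
  simp [Algebra.algebraMap_eq_smul_one, smul_smul]

/-- The `R`-smash product of Hopf algebras is a Hopf algebra with antipode
`S (u # h) = (S u)^R # (S h)^R`. -/
noncomputable instance : HopfAlgebra k (Smash R) where
  antipode := smashAntipode R
  mul_antipode_rTensor_comul := smashAntipode_mul_id R
  mul_antipode_lTensor_comul := id_mul_smashAntipode R

end SmashHopf

section PartialRep

open Coalgebra HopfAlgebra

variable {k : Type*} [Field k] {A : Type*} [Ring A] [HopfAlgebra k A]
  {B : Type*} [Ring B] [Algebra k B]

/-- A partial representation of the Hopf algebra `A` on the algebra `B`: a linear map `π` with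
`π 1 = 1`, `π(h) π(a₁) π(S a₂) = π(h a₁) π(S a₂)` and `π(a₁) π(S a₂) π(h) = π(a₁) π(S(a₂) h)`
for all `h, a`. -/
structure IsPartialRep (π : A →ₗ[k] B) : Prop where
  map_one : π 1 = 1
  mul_left (h a : A) :
    π h * LinearMap.mul' k B (TensorProduct.map π (π ∘ₗ antipode k) (comul (R := k) a)) =
      LinearMap.mul' k B (TensorProduct.map (π ∘ₗ LinearMap.mulLeft k h) (π ∘ₗ antipode k)
        (comul (R := k) a))
  mul_right (a h : A) :
    LinearMap.mul' k B (TensorProduct.map π (π ∘ₗ antipode k) (comul (R := k) a)) * π h =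
      LinearMap.mul' k B (TensorProduct.map π (π ∘ₗ LinearMap.mulRight k h ∘ₗ antipode k)
        (comul (R := k) a))

variable (k A)

/-- The relations on the tensor algebra `T(A)` defining `A_par`:
`1_A = 1`, `h ⊗ a₁ ⊗ S a₂ = h a₁ ⊗ S a₂` and `a₁ ⊗ S a₂ ⊗ h = a₁ ⊗ S(a₂) h`. -/
inductive ParRel : TensorAlgebra k A → TensorAlgebra k A → Prop
  | one : ParRel (TensorAlgebra.ι k (1 : A)) 1
  | mul_left (h a : A) : ParRel
      (TensorAlgebra.ι k h * LinearMap.mul' k (TensorAlgebra k A) (TensorProduct.map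
        (TensorAlgebra.ι k) (TensorAlgebra.ι k ∘ₗ antipode k) (comul (R := k) a)))
      (LinearMap.mul' k (TensorAlgebra k A) (TensorProduct.map
        (TensorAlgebra.ι k ∘ₗ LinearMap.mulLeft k h) (TensorAlgebra.ι k ∘ₗ antipode k)
        (comul (R := k) a)))
  | mul_right (a h : A) : ParRel
      (LinearMap.mul' k (TensorAlgebra k A) (TensorProduct.map
        (TensorAlgebra.ι k) (TensorAlgebra.ι k ∘ₗ antipode k) (comul (R := k) a)) *
        TensorAlgebra.ι k h)
      (LinearMap.mul' k (TensorAlgebra k A) (TensorProduct.map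
        (TensorAlgebra.ι k) (TensorAlgebra.ι k ∘ₗ LinearMap.mulRight k h ∘ₗ antipode k)
        (comul (R := k) a)))

/-- The partial "Hopf" algebra `A_par`, the quotient of `T(A)` by the relations `ParRel`. -/
def Par : Type _ := RingQuot (ParRel k A)

noncomputable instance : Ring (Par k A) := inferInstanceAs (Ring (RingQuot (ParRel k A)))

noncomputable instance : Algebra k (Par k A) :=
  inferInstanceAs (Algebra k (RingQuot (ParRel k A)))

/-- The quotient map `T(A) → A_par`, `a₁ ⊗ ⋯ ⊗ aₙ ↦ [a₁] ⋯ [aₙ]`. -/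
noncomputable def Par.proj : TensorAlgebra k A →ₐ[k] Par k A := RingQuot.mkAlgHom k (ParRel k A)

end PartialRep

section Twist

variable {k : Type*} [Field k]
  {U : Type*} [Ring U] [Algebra k U] {H : Type*} [Ring H] [Algebra k H]
  (R : H ⊗[k] U →ₗ[k] U ⊗[k] H)

/-- For `u : U`, the endomorphism `t ⊗ h ↦ (t ⊗ u^R) ⊗ h^R` of `T(U) ⊗ H`. -/
noncomputable def passRight :
    U →ₗ[k] Module.End k (TensorAlgebra k U ⊗[k] H) :=
  (TensorProduct.curry
    ((LinearMap.mul' k (TensorAlgebra k U)).rTensor H ∘ₗ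
      (TensorProduct.assoc k (TensorAlgebra k U) (TensorAlgebra k U) H).symm.toLinearMap ∘ₗ
      ((TensorAlgebra.ι k).rTensor H ∘ₗ R).lTensor (TensorAlgebra k U) ∘ₗ
      (TensorProduct.assoc k (TensorAlgebra k U) H U).toLinearMap)).flip

/-- Moving one element of `H` past a word in `U`, letter by letter from left to right:
`h ⊗ (u₁ ⊗ ⋯ ⊗ uₘ) ↦ (u₁^{R₁} ⊗ ⋯ ⊗ uₘ^{Rₘ}) ⊗ h^{R₁ ⋯ Rₘ}`. -/
noncomputable def passWord : H ⊗[k] TensorAlgebra k U →ₗ[k] TensorAlgebra k U ⊗[k] H :=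
  TensorProduct.lift
    (((MulOpposite.opLinearEquiv k).symm.toLinearMap ∘ₗ
      (TensorAlgebra.lift k ((MulOpposite.opLinearEquiv k).toLinearMap ∘ₗ
        passRight R)).toLinearMap).compl₂ (TensorProduct.mk k (TensorAlgebra k U) H 1)).flip

/-- For `h : H`, the endomorphism of `T(U) ⊗ T(H)` moving `h` past the word on the left and
putting the result in front of the word on the right. -/
noncomputable def passLeft :
    H →ₗ[k] Module.End k (TensorAlgebra k U ⊗[k] TensorAlgebra k H) :=
  TensorProduct.curry
    ((LinearMap.mul' k (TensorAlgebra k H)).lTensor (TensorAlgebra k U) ∘ₗ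
      (TensorProduct.assoc k (TensorAlgebra k U) (TensorAlgebra k H)
        (TensorAlgebra k H)).toLinearMap ∘ₗ
      ((TensorAlgebra.ι k).lTensor (TensorAlgebra k U) ∘ₗ passWord R).rTensor
        (TensorAlgebra k H) ∘ₗ
      (TensorProduct.assoc k H (TensorAlgebra k U) (TensorAlgebra k H)).symm.toLinearMap)

/-- Moving a word in `H` past a word in `U` by repeated use of `R`:
`(h₁ ⊗ ⋯ ⊗ hₙ) ⊗ (u₁ ⊗ ⋯ ⊗ uₘ)` is sent to
`(u₁^{R₁₁ ⋯ R₁ₙ} ⊗ ⋯ ⊗ uₘ^{Rₘ₁ ⋯ Rₘₙ}) ⊗ (h₁^{R₁ₙ ⋯ Rₘₙ} ⊗ ⋯ ⊗ hₙ^{R₁₁ ⋯ Rₘ₁})`. -/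
noncomputable def wordTwist :
    TensorAlgebra k H ⊗[k] TensorAlgebra k U →ₗ[k] TensorAlgebra k U ⊗[k] TensorAlgebra k H :=
  TensorProduct.lift ((TensorAlgebra.lift k (passLeft R)).toLinearMap.compl₂
    ((TensorProduct.mk k (TensorAlgebra k U) (TensorAlgebra k H)).flip 1))

theorem passRight_apply (u : U) (t : TensorAlgebra k U) (h : H) :
    passRight R u (t ⊗ₜ h) =
      ((LinearMap.mulLeft k t) ∘ₗ TensorAlgebra.ι k).rTensor H (R (h ⊗ₜ u)) := by
  simp only [passRight, LinearMap.flip_apply, TensorProduct.curry_apply, LinearMap.comp_apply,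
    LinearEquiv.coe_coe, TensorProduct.assoc_tmul, LinearMap.lTensor_tmul]
  induction R (h ⊗ₜ u) with
  | zero => simp
  | add x y hx hy => simp only [tmul_add, map_add, hx, hy]
  | tmul a b => simp

theorem passWord_one (h : H) : passWord R (h ⊗ₜ 1) = 1 ⊗ₜ h := by
  simp [passWord]

theorem passWord_mul_ι (h : H) (t : TensorAlgebra k U) (u : U) :
    passWord R (h ⊗ₜ (t * TensorAlgebra.ι k u)) = passRight R u (passWord R (h ⊗ₜ t)) := by
  simp [passWord]

theorem passLeft_apply (h : H) (t : TensorAlgebra k U) (x : TensorAlgebra k H) :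
    passLeft R h (t ⊗ₜ x) =
      ((LinearMap.mulRight k x) ∘ₗ TensorAlgebra.ι k).lTensor (TensorAlgebra k U)
        (passWord R (h ⊗ₜ t)) := by
  simp only [passLeft, TensorProduct.curry_apply, LinearMap.comp_apply,
    LinearEquiv.coe_coe, TensorProduct.assoc_symm_tmul, LinearMap.rTensor_tmul]
  induction passWord R (h ⊗ₜ t) with
  | zero => simp
  | add x y hx hy => simp only [add_tmul, map_add, hx, hy]
  | tmul a b => simp

theorem wordTwist_one (t : TensorAlgebra k U) : wordTwist R (1 ⊗ₜ t) = t ⊗ₜ 1 := by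
  simp [wordTwist]

theorem wordTwist_ι_mul (h : H) (x : TensorAlgebra k H) (t : TensorAlgebra k U) :
    wordTwist R ((TensorAlgebra.ι k h * x) ⊗ₜ t) = passLeft R h (wordTwist R (x ⊗ₜ t)) := by
  simp [wordTwist]

end Twist

section ParTwist

variable {k : Type*} [Field k]
  {U : Type*} [Ring U] [HopfAlgebra k U] {H : Type*} [Ring H] [HopfAlgebra k H]
  (R : H ⊗[k] U →ₗ[k] U ⊗[k] H)

/-- The linear map `T(H) ⊗ T(U) → U_par ⊗ H_par`,
`(h₁ ⊗ ⋯ ⊗ hₙ) ⊗ (u₁ ⊗ ⋯ ⊗ uₘ) ↦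
[u₁^{R₁₁ ⋯ R₁ₙ}] ⋯ [uₘ^{Rₘ₁ ⋯ Rₘₙ}] ⊗ [h₁^{R₁ₙ ⋯ Rₘₙ}] ⋯ [hₙ^{R₁₁ ⋯ Rₘ₁}]`. -/
noncomputable def parWordTwist :
    TensorAlgebra k H ⊗[k] TensorAlgebra k U →ₗ[k] Par k U ⊗[k] Par k H :=
  TensorProduct.map (Par.proj k U).toLinearMap (Par.proj k H).toLinearMap ∘ₗ wordTwist R

/-- `T` is the map `H_par ⊗ U_par → U_par ⊗ H_par` induced by `R`:
`[h₁] ⋯ [hₙ] ⊗ [u₁] ⋯ [uₘ]` is sent to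
`[u₁^{R₁₁ ⋯ R₁ₙ}] ⋯ [uₘ^{Rₘ₁ ⋯ Rₘₙ}] ⊗ [h₁^{R₁ₙ ⋯ Rₘₙ}] ⋯ [hₙ^{R₁₁ ⋯ Rₘ₁}]`.
There is at most one such `T`, since the quotient maps are surjective. -/
def IsInducedTwist (T : Par k H ⊗[k] Par k U →ₗ[k] Par k U ⊗[k] Par k H) : Prop :=
  T ∘ₗ TensorProduct.map (Par.proj k H).toLinearMap (Par.proj k U).toLinearMap = parWordTwist R

end ParTwist

section Categories

variable {k : Type*} [Field k]

section Pairs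

variable {U : Type*} [Ring U] [HopfAlgebra k U] {H : Type*} [Ring H] [HopfAlgebra k H]

/-- Objects of `𝒫^R_{U,H}`: pairs of partial representations `α : U → B`, `η : H → B` on an
algebra `B` such that `η(h) α(u) = α(u^R) η(h^R)`. -/
structure CompatiblePair (R : H ⊗[k] U →ₗ[k] U ⊗[k] H) where
  alg : AlgCat.{w} k
  α : U →ₗ[k] alg
  η : H →ₗ[k] alg
  isPartialRep_α : IsPartialRep α
  isPartialRep_η : IsPartialRep η
  compat (u : U) (h : H) :
    η h * α u = LinearMap.mul' k alg (TensorProduct.map α η (R (h ⊗ₜ[k] u)))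

namespace CompatiblePair

variable {R : H ⊗[k] U →ₗ[k] U ⊗[k] H}

/-- Morphisms: algebra maps `f : B → B'` with `f ∘ α = α'` and `f ∘ η = η'`. -/
@[ext]
structure Hom (X Y : CompatiblePair.{w} R) where
  algHom : X.alg →ₐ[k] Y.alg
  comp_α : algHom.toLinearMap ∘ₗ X.α = Y.α
  comp_η : algHom.toLinearMap ∘ₗ X.η = Y.η

noncomputable instance : Category (CompatiblePair.{w} R) where
  Hom := Hom
  id X := ⟨AlgHom.id k X.alg, rfl, rfl⟩
  comp f g := ⟨g.algHom.comp f.algHom,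
    by rw [← g.comp_α, ← f.comp_α]; rfl, by rw [← g.comp_η, ← f.comp_η]; rfl⟩

/-- The functor sending a pair of partial representations to its target algebra. -/
noncomputable def target : CompatiblePair.{w} R ⥤ AlgCat.{w} k where
  obj X := X.alg
  map f := AlgCat.ofHom (Hom.algHom f)

end CompatiblePair

/-- Objects of `PRep^split_{U #_R H}`: partial representations `π : U #_R H → B` such that
`π(u # h) = π(u # 1) π(1 # h)` and `π(u^R # h^R) = π(1 # h) π(u # 1)`. -/
structure SplitPartialRep (R : H ⊗[k] U →ₗ[k] U ⊗[k] H)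
    [IsNormal R] [IsMultiplicative R] [IsCoalgMap R] where
  alg : AlgCat.{w} k
  π : Smash R →ₗ[k] alg
  isPartialRep : IsPartialRep π
  split_left (u : U) (h : H) : π (Smash.mk R u h) = π (Smash.mk R u 1) * π (Smash.mk R 1 h)
  split_right (u : U) (h : H) :
    π (Smash.of R (R (h ⊗ₜ[k] u))) = π (Smash.mk R 1 h) * π (Smash.mk R u 1)

namespace SplitPartialRep

variable {R : H ⊗[k] U →ₗ[k] U ⊗[k] H} [IsNormal R] [IsMultiplicative R] [IsCoalgMap R]

/-- Morphisms: algebra maps `f : B → B'` with `f ∘ π = π'`. -/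
@[ext]
structure Hom (X Y : SplitPartialRep.{w} R) where
  algHom : X.alg →ₐ[k] Y.alg
  comp_π : algHom.toLinearMap ∘ₗ X.π = Y.π

noncomputable instance : Category (SplitPartialRep.{w} R) where
  Hom := Hom
  id X := ⟨AlgHom.id k X.alg, rfl⟩
  comp f g := ⟨g.algHom.comp f.algHom, by rw [← g.comp_π, ← f.comp_π]; rfl⟩

/-- The functor sending a partial representation to its target algebra. -/
noncomputable def target : SplitPartialRep.{w} R ⥤ AlgCat.{w} k where
  obj X := X.alg
  map f := AlgCat.ofHom (Hom.algHom f)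

end SplitPartialRep

end Pairs

section Reps

variable (k) (A : Type*) [Ring A] [Algebra k A]

/-- Objects of `Rep_A`: algebra maps `σ : A → B`. -/
structure AlgRep where
  alg : AlgCat.{w} k
  σ : A →ₐ[k] alg

namespace AlgRep

variable {k A}

/-- Morphisms: algebra maps `f : B → B'` with `f ∘ σ = σ'`. -/
@[ext]
structure Hom (X Y : AlgRep.{w} k A) where
  algHom : X.alg →ₐ[k] Y.alg
  comp_σ : algHom.comp X.σ = Y.σ

noncomputable instance : Category (AlgRep.{w} k A) where
  Hom := Hom
  id X := ⟨AlgHom.id k X.alg, rfl⟩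
  comp f g := ⟨g.algHom.comp f.algHom, by rw [← g.comp_σ, ← f.comp_σ]; rfl⟩

/-- The functor sending a representation to its target algebra. -/
noncomputable def target : AlgRep.{w} k A ⥤ AlgCat.{w} k where
  obj X := X.alg
  map f := AlgCat.ofHom (Hom.algHom f)

end AlgRep

end Reps

end Categories

end PartialHopf

open PartialHopf

/-! The relations of A_par and the axioms of a partial representation involve only the elements a₁ ⊗
S(a₂) of A ⊗ A, multiplied from the left in the first leg or from the right in the second. So
everything rests on one point: crossing such an element by R produces elements of the same kind.
This is `passTwo_twistedComul` for U and `passPair_twistedComul` for H. Both are proved after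
applying the canonical map x ⊗ y ↦ x₁ ⊗ x₂y, which is injective and has a₁ ⊗ S(a₂) as a preimage of
a ⊗ 1. Since R is a multiplicative coalgebra map, the two successive crossings then become an action
on one leg and a single R on a product; that product collapses to 1 by the antipode identity, and
normality disposes of it.

The twist is built in two stages, with the universal property of A_par replacing any check on
ideals. The operators on U_par ⊗ H that let a letter of U be crossed form a partial representation
of U (`isPartialRep_letterPass`), hence extend to U_par; the resulting operators of H on U_par ⊗
H_par form a partial representation of H (`isPartialRep_wordPass`), hence extend to H_par.
Normality, multiplicativity and the formula on words follow by induction on words.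

For the categories, a compatible pair gives π(u # h) = α(u)η(h), and the substantial claim is that π
is partial (`isPartialRep_pairMap`). Put e_h = η(h₁)η(S h₂). For x = u # h one finds π(x₁)π(S x₂) =
α(u₁) e_h α(S u₂). The axioms for η act inside e_h. To use those for α, e_h is moved to the right
past α(S u₂): it becomes some e_c with c depending on h and on a third leg u₃, so that α(u₁)α(S u₂)
stands together and the axioms for α apply. Restriction to U and H inverts this construction, and
the universal properties of the smash product and of A_par identify pairs with algebra maps. No
construction changes the target algebra, so these are isomorphisms, not mere equivalences. -/

namespace PartialHopf

/-! ### Convolution calculus and the elements a₁ ⊗ S(a₂). -/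

section Convolution

open Coalgebra HopfAlgebra

variable {k : Type*} [Field k]

section Basic

variable {C : Type*} [AddCommGroup C] [Module k C] [Coalgebra k C]
  {A : Type*} [Ring A] [Algebra k A] {A' : Type*} [Ring A'] [Algebra k A']

/-- The convolution product of linear maps from a coalgebra to an algebra. -/
noncomputable def conv (f g : C →ₗ[k] A) : C →ₗ[k] A :=
  LinearMap.mul' k A ∘ₗ TensorProduct.map f g ∘ₗ comul

theorem conv_apply (f g : C →ₗ[k] A) (c : C) :
    conv f g c = LinearMap.mul' k A (TensorProduct.map f g (comul c)) := rfl

theorem conv_eq (f g : C →ₗ[k] A) :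
    conv f g = (WithConv.toConv f * WithConv.toConv g).ofConv := rfl

theorem conv_assoc (f g h : C →ₗ[k] A) : conv (conv f g) h = conv f (conv g h) := by
  simp only [conv_eq, WithConv.toConv_ofConv, mul_assoc]

theorem algHom_comp_conv (φ : A →ₐ[k] A') (f g : C →ₗ[k] A) :
    φ.toLinearMap ∘ₗ conv f g = conv (φ.toLinearMap ∘ₗ f) (φ.toLinearMap ∘ₗ g) := by
  ext c
  simp only [LinearMap.comp_apply, conv_apply]
  induction comul (R := k) c with
  | zero => simp
  | tmul x y => simp
  | add x y hx hy => simp only [map_add, hx, hy]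

variable (k C A) in
/-- The unit for convolution. -/
noncomputable def convOne : C →ₗ[k] A := Algebra.linearMap k A ∘ₗ counit

theorem convOne_eq : convOne k C A = (1 : WithConv (C →ₗ[k] A)).ofConv := rfl

theorem convOne_conv (f : C →ₗ[k] A) : conv (convOne k C A) f = f := by
  simp only [conv_eq, convOne_eq, WithConv.toConv_ofConv, one_mul]

theorem conv_convOne (f : C →ₗ[k] A) : conv f (convOne k C A) = f := by
  simp only [conv_eq, convOne_eq, WithConv.toConv_ofConv, mul_one]

theorem algHom_comp_convOne (φ : A →ₐ[k] A') :
    φ.toLinearMap ∘ₗ convOne k C A = convOne k C A' := by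
  ext c
  simp [convOne]

theorem conv_left_inv_unique {f g h : C →ₗ[k] A} (h₁ : conv f g = convOne k C A)
    (h₂ : conv g h = convOne k C A) : f = h := by
  rw [← conv_convOne f, ← h₂, ← conv_assoc, h₁, convOne_conv]

end Basic

section Hopf

variable {A : Type*} [Ring A] [HopfAlgebra k A] {B : Type*} [Ring B] [Algebra k B]

theorem conv_antipode_algHom (φ : A →ₐ[k] B) :
    conv (φ.toLinearMap ∘ₗ antipode k) φ.toLinearMap = convOne k A B := by
  have h : conv (antipode k) (LinearMap.id : A →ₗ[k] A) = convOne k A A :=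
    congrArg WithConv.ofConv (LinearMap.antipode_mul_id (R := k) (C := A))
  rw [← algHom_comp_convOne φ, ← h, algHom_comp_conv, LinearMap.comp_id]

theorem conv_algHom_antipode (φ : A →ₐ[k] B) :
    conv φ.toLinearMap (φ.toLinearMap ∘ₗ antipode k) = convOne k A B := by
  have h : conv (LinearMap.id : A →ₗ[k] A) (antipode k) = convOne k A A :=
    congrArg WithConv.ofConv (LinearMap.id_mul_antipode (R := k) (C := A))
  rw [← algHom_comp_convOne φ, ← h, algHom_comp_conv, LinearMap.comp_id]

variable (k A)

/-- The left inclusion `A → A ⊗ A` as an algebra map. -/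
noncomputable abbrev tinl : A →ₐ[k] A ⊗[k] A := Algebra.TensorProduct.includeLeft

/-- The right inclusion `A → A ⊗ A` as an algebra map. -/
noncomputable abbrev tinr : A →ₐ[k] A ⊗[k] A := Algebra.TensorProduct.includeRight

theorem comul_eq_conv :
    (comul : A →ₗ[k] A ⊗[k] A) = conv (tinl k A).toLinearMap (tinr k A).toLinearMap := by
  ext a
  rw [conv_apply]
  induction comul (R := k) a with
  | zero => simp
  | tmul x y => simp
  | add x y hx hy => rw [map_add, map_add, ← hx, ← hy]

/-- The antipode reverses comultiplication because both sides are convolution inverses of Δ in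
Hom(A, A ⊗ A): one on the left, the other on the right. -/
theorem comul_comp_antipode :
    (comul : A →ₗ[k] A ⊗[k] A) ∘ₗ antipode k =
      conv ((tinr k A).toLinearMap ∘ₗ antipode k) ((tinl k A).toLinearMap ∘ₗ antipode k) := by
  refine (conv_left_inv_unique (g := comul) ?_ ?_).symm
  · rw [comul_eq_conv, conv_assoc, ← conv_assoc ((tinl k A).toLinearMap ∘ₗ antipode k),
      conv_antipode_algHom, convOne_conv, conv_antipode_algHom]
  · exact conv_algHom_antipode (Bialgebra.comulAlgHom k A)

/-- The map `a ↦ a₁ ⊗ S a₂`. -/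
noncomputable def twistedComul : A →ₗ[k] A ⊗[k] A := (antipode k).lTensor A ∘ₗ comul

theorem twistedComul_eq_conv :
    twistedComul k A = conv (tinl k A).toLinearMap ((tinr k A).toLinearMap ∘ₗ antipode k) := by
  ext a
  rw [conv_apply, twistedComul, LinearMap.comp_apply]
  induction comul (R := k) a with
  | zero => simp
  | tmul x y => simp
  | add x y hx hy => rw [map_add, map_add, map_add, ← hx, ← hy]

/-- The linear map `x ⊗ y ↦ x₁ ⊗ x₂ y`. -/
noncomputable def canMap : A ⊗[k] A →ₗ[k] A ⊗[k] A :=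
  LinearMap.mul' k (A ⊗[k] A) ∘ₗ TensorProduct.map comul (tinr k A).toLinearMap

/-- The inverse `x ⊗ y ↦ x₁ ⊗ S(x₂) y` of `canMap`. -/
noncomputable def canInv : A ⊗[k] A →ₗ[k] A ⊗[k] A :=
  LinearMap.mul' k (A ⊗[k] A) ∘ₗ TensorProduct.map (twistedComul k A) (tinr k A).toLinearMap

variable {A}

theorem canMap_tmul (x y : A) : canMap k A (x ⊗ₜ y) = comul (R := k) x * (1 ⊗ₜ y) := rfl

theorem canInv_tmul (x y : A) : canInv k A (x ⊗ₜ y) = twistedComul k A x * (1 ⊗ₜ y) := rfl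

theorem canInv_tmul_one (x : A) : canInv k A (x ⊗ₜ 1) = twistedComul k A x := by
  rw [canInv_tmul, ← Algebra.TensorProduct.one_def, mul_one]

/-- With i₁, i₂ the two inclusions into A ⊗ A, this is i₁ * i₂ * (i₂ ∘ S) = i₁ in the convolution
algebra. -/
theorem canMap_twistedComul (a : A) : canMap k A (twistedComul k A a) = a ⊗ₜ 1 := by
  have h : ∀ z : A ⊗[k] A, canMap k A ((antipode k).lTensor A z) = LinearMap.mul' k _
      (TensorProduct.map comul ((tinr k A).toLinearMap ∘ₗ antipode k) z) := by
    intro z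
    induction z with
    | zero => simp
    | tmul x y => simp [canMap]
    | add x y hx hy => simp only [map_add, hx, hy]
  rw [twistedComul, LinearMap.comp_apply, h, ← conv_apply, comul_eq_conv, conv_assoc,
    conv_algHom_antipode, conv_convOne]
  rfl

/-- The cancellation is i₁ * (i₂ ∘ S) * i₂ = i₁. This one-sided inverse suffices: it makes `canMap`
injective, so crossings may be compared after applying it. -/
theorem canInv_canMap (z : A ⊗[k] A) : canInv k A (canMap k A z) = z := by
  induction z with
  | zero => simp
  | add x y hx hy => simp only [map_add, hx, hy]
  | tmul x y =>
    have h : ∀ z : A ⊗[k] A, canInv k A (z * (1 ⊗ₜ y)) = LinearMap.mul' k _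
        (TensorProduct.map (twistedComul k A) (tinr k A).toLinearMap z) * (1 ⊗ₜ y) := by
      intro z
      induction z with
      | zero => simp
      | tmul x y => simp [canInv, mul_assoc]
      | add x y hx hy => simp only [map_add, add_mul, hx, hy]
    rw [canMap_tmul, h, ← conv_apply, twistedComul_eq_conv, conv_assoc, conv_antipode_algHom,
      conv_convOne]
    simp

/-- The linear map `g ⊗ h ↦ (g₁ ⊗ h₁) ⊗ g₂ h₂`. -/
noncomputable def comulMul (A : Type*) [Ring A] [HopfAlgebra k A] :
    A ⊗[k] A →ₗ[k] (A ⊗[k] A) ⊗[k] A :=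
  (LinearMap.mul' k A).lTensor (A ⊗[k] A) ∘ₗ comul

/-- In terms of the three inclusions into A ⊗ A ⊗ A, the left side is i₁ * i₃ * (i₃ ∘ S) * (i₂ ∘ S),
since S reverses Δ; the middle factors cancel. In Sweedler notation: a₁ ⊗ S(a₄) ⊗ a₂S(a₃) = a₁ ⊗
S(a₂) ⊗ 1. -/
theorem comulMul_twistedComul (a : A) :
    comulMul k A (twistedComul k A a) = twistedComul k A a ⊗ₜ 1 := by
  let i₁ : A →ₐ[k] (A ⊗[k] A) ⊗[k] A := Algebra.TensorProduct.includeLeft.comp (tinl k A)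
  let i₂ : A →ₐ[k] (A ⊗[k] A) ⊗[k] A := Algebra.TensorProduct.includeLeft.comp (tinr k A)
  let i₃ : A →ₐ[k] (A ⊗[k] A) ⊗[k] A := Algebra.TensorProduct.includeRight
  let i₁₃ : A ⊗[k] A →ₐ[k] (A ⊗[k] A) ⊗[k] A :=
    Algebra.TensorProduct.map (tinl k A) (AlgHom.id k A)
  let i₂₃ : A ⊗[k] A →ₐ[k] (A ⊗[k] A) ⊗[k] A :=
    Algebra.TensorProduct.map (tinr k A) (AlgHom.id k A)
  have h1 : ∀ g h : A, comulMul k A (g ⊗ₜ h) = i₁₃ (comul (R := k) g) * i₂₃ (comul (R := k) h) := by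
    intro g h
    rw [comulMul, LinearMap.comp_apply, TensorProduct.comul_tmul]
    generalize comul (R := k) g = x
    generalize comul (R := k) h = y
    induction x with
    | zero => simp
    | add x x' hx hx' => simp only [add_tmul, map_add, add_mul, hx, hx']
    | tmul a b =>
    induction y with
    | zero => simp
    | add x x' hx hx' => simp only [tmul_add, map_add, mul_add, hx, hx']
    | tmul c d => simp [i₁₃, i₂₃]
  have h2 : ∀ z : A ⊗[k] A, comulMul k A ((antipode k).lTensor A z) = LinearMap.mul' k _
      (TensorProduct.map (i₁₃.toLinearMap ∘ₗ comul) (i₂₃.toLinearMap ∘ₗ comul ∘ₗ antipode k) z) := by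
    intro z
    induction z with
    | zero => simp
    | tmul x y => simp [h1]
    | add x y hx hy => simp only [map_add, hx, hy]
  have h3 : i₁₃.toLinearMap ∘ₗ (tinl k A).toLinearMap = i₁.toLinearMap := by
    ext a; simp [i₁₃, i₁]
  have h4 : i₁₃.toLinearMap ∘ₗ (tinr k A).toLinearMap = i₃.toLinearMap := by
    ext a; simp [i₁₃, i₃, Algebra.TensorProduct.one_def]
  have h5 : i₂₃.toLinearMap ∘ₗ (tinl k A).toLinearMap = i₂.toLinearMap := by
    ext a; simp [i₂₃, i₂]
  have h6 : i₂₃.toLinearMap ∘ₗ (tinr k A).toLinearMap = i₃.toLinearMap := by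
    ext a; simp [i₂₃, i₃, Algebra.TensorProduct.one_def]
  have h7 : twistedComul k A a ⊗ₜ[k] (1 : A) =
      conv i₁.toLinearMap (i₂.toLinearMap ∘ₗ antipode k) a := by
    have h := algHom_comp_conv
      (Algebra.TensorProduct.includeLeft : A ⊗[k] A →ₐ[k] (A ⊗[k] A) ⊗[k] A)
      (tinl k A).toLinearMap ((tinr k A).toLinearMap ∘ₗ antipode k)
    rw [← twistedComul_eq_conv] at h
    exact LinearMap.congr_fun h a
  rw [h7, twistedComul, LinearMap.comp_apply, h2, ← conv_apply, comul_comp_antipode, comul_eq_conv,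
    algHom_comp_conv, algHom_comp_conv, ← LinearMap.comp_assoc, ← LinearMap.comp_assoc, h3, h4, h5,
    h6, conv_assoc, ← conv_assoc i₃.toLinearMap, conv_algHom_antipode, convOne_conv]

/-- `u₁ ⊗ S(u₂)₂ ⊗ S(u₂)₁ = u₁ ⊗ S(u₂) ⊗ S(u₃)`. -/
theorem lTensor_comm_comul_antipode (a : A) :
    ((TensorProduct.comm k A A).toLinearMap ∘ₗ comul).lTensor A (twistedComul k A a) =
      TensorProduct.assoc k A A A (TensorProduct.map (twistedComul k A) (antipode k)
        (comul (R := k) a)) := by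
  let i₁ : A →ₐ[k] A ⊗[k] (A ⊗[k] A) := Algebra.TensorProduct.includeLeft
  let i₂ : A →ₐ[k] A ⊗[k] (A ⊗[k] A) := Algebra.TensorProduct.includeRight.comp (tinl k A)
  let i₃ : A →ₐ[k] A ⊗[k] (A ⊗[k] A) := Algebra.TensorProduct.includeRight.comp (tinr k A)
  let c : A ⊗[k] A →ₐ[k] A ⊗[k] (A ⊗[k] A) := Algebra.TensorProduct.includeRight.comp
    (Algebra.TensorProduct.comm k A A).toAlgHom
  let i₁₂ : A ⊗[k] A →ₐ[k] A ⊗[k] (A ⊗[k] A) :=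
    Algebra.TensorProduct.map (AlgHom.id k A) (tinl k A)
  have hl : ∀ z : A ⊗[k] A, ((TensorProduct.comm k A A).toLinearMap ∘ₗ comul).lTensor A
      ((antipode k).lTensor A z) = LinearMap.mul' k _
      (TensorProduct.map i₁.toLinearMap (c.toLinearMap ∘ₗ comul ∘ₗ antipode k) z) := by
    intro z
    induction z with
    | zero => simp
    | tmul x y =>
      simp only [LinearMap.lTensor_tmul, map_tmul, LinearMap.comp_apply, LinearMap.mul'_apply]
      generalize comul (R := k) (antipode k y) = t
      induction t with
      | zero => simp
      | tmul x y => simp [i₁, c]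
      | add x y hx hy => simp only [map_add, mul_add, tmul_add, hx, hy]
    | add x y hx hy => simp only [map_add, hx, hy]
  have hr : ∀ z : A ⊗[k] A, TensorProduct.assoc k A A A
      (TensorProduct.map (twistedComul k A) (antipode k) z) = LinearMap.mul' k _
      (TensorProduct.map (i₁₂.toLinearMap ∘ₗ twistedComul k A)
        (i₃.toLinearMap ∘ₗ antipode k) z) := by
    intro z
    induction z with
    | zero => simp
    | tmul x y =>
      simp only [map_tmul, LinearMap.comp_apply, LinearMap.mul'_apply]
      generalize twistedComul k A x = t
      induction t with
      | zero => simp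
      | tmul x y => simp [i₁₂, i₃]
      | add x y hx hy => simp only [map_add, add_mul, add_tmul, hx, hy]
    | add x y hx hy => simp only [map_add, hx, hy]
  have h1 : c.toLinearMap ∘ₗ (tinl k A).toLinearMap = i₃.toLinearMap := by
    ext a; simp [c, i₃]
  have h2 : c.toLinearMap ∘ₗ (tinr k A).toLinearMap = i₂.toLinearMap := by
    ext a; simp [c, i₂]
  have h3 : i₁₂.toLinearMap ∘ₗ (tinl k A).toLinearMap = i₁.toLinearMap := by
    ext a; simp [i₁₂, i₁, Algebra.TensorProduct.one_def]
  have h4 : i₁₂.toLinearMap ∘ₗ (tinr k A).toLinearMap = i₂.toLinearMap := by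
    ext a; simp [i₁₂, i₂]
  -- Both sides are the convolution product i₁ * (i₂ ∘ S) * (i₃ ∘ S), the flip undoing the reversal
  -- by S.
  rw [hr, ← conv_apply, twistedComul_eq_conv, ← twistedComul_eq_conv, twistedComul,
    LinearMap.comp_apply, hl, ← conv_apply, ← twistedComul, twistedComul_eq_conv,
    comul_comp_antipode, algHom_comp_conv, algHom_comp_conv, ← LinearMap.comp_assoc,
    ← LinearMap.comp_assoc, ← LinearMap.comp_assoc, h1, h2, h3, h4, conv_assoc]

end Hopf

end Convolution

end PartialHopf

namespace PartialHopf

/-! ### Crossing operators attached to a twist, and multiplicativity in operator form. -/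

section Passing

variable {k : Type*} [Field k]

section Operators

variable {P : Type*} [Ring P] [Algebra k P] {V : Type*} [Ring V] [Algebra k V]
  {X : Type*} [AddCommGroup X] [Module k X]

/-- For `τ : V ⊗ X → P ⊗ V`, the operators `p ⊗ v ↦ (p ⊗ 1) τ(v ⊗ x)`. -/
noncomputable def opr (τ : V ⊗[k] X →ₗ[k] P ⊗[k] V) : X →ₗ[k] Module.End k (P ⊗[k] V) where
  toFun x := LinearMap.mul' k (P ⊗[k] V) ∘ₗ TensorProduct.map
    (Algebra.TensorProduct.includeLeft : P →ₐ[k] P ⊗[k] V).toLinearMap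
    (τ ∘ₗ (TensorProduct.mk k V X).flip x)
  map_add' x y := by
    refine TensorProduct.ext' fun p v => ?_
    simp [tmul_add]
  map_smul' c x := by
    refine TensorProduct.ext' fun p v => ?_
    simp

theorem opr_tmul (τ : V ⊗[k] X →ₗ[k] P ⊗[k] V) (x : X) (p : P) (v : V) :
    opr τ x (p ⊗ₜ v) = (p ⊗ₜ 1) * τ (v ⊗ₜ x) := rfl

theorem opr_mul (τ : V ⊗[k] X →ₗ[k] P ⊗[k] V) (x : X) (p : P) (Z : P ⊗[k] V) :
    opr τ x ((p ⊗ₜ 1) * Z) = (p ⊗ₜ 1) * opr τ x Z := by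
  induction Z with
  | zero => simp
  | add a b ha hb => simp only [mul_add, map_add, ha, hb]
  | tmul a b =>
    rw [Algebra.TensorProduct.tmul_mul_tmul, one_mul, opr_tmul, opr_tmul, ← mul_assoc,
      Algebra.TensorProduct.tmul_mul_tmul, one_mul]

/-- For `τ : X ⊗ P → P ⊗ V`, the operators `p ⊗ v ↦ τ(x ⊗ p) (1 ⊗ v)`. -/
noncomputable def opl (τ : X ⊗[k] P →ₗ[k] P ⊗[k] V) : X →ₗ[k] Module.End k (P ⊗[k] V) where
  toFun x := LinearMap.mul' k (P ⊗[k] V) ∘ₗ TensorProduct.map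
    (τ ∘ₗ TensorProduct.mk k X P x)
    (Algebra.TensorProduct.includeRight : V →ₐ[k] P ⊗[k] V).toLinearMap
  map_add' x y := by
    refine TensorProduct.ext' fun p v => ?_
    simp [add_tmul]
  map_smul' c x := by
    refine TensorProduct.ext' fun p v => ?_
    simp [← smul_tmul']

theorem opl_tmul (τ : X ⊗[k] P →ₗ[k] P ⊗[k] V) (x : X) (p : P) (v : V) :
    opl τ x (p ⊗ₜ v) = τ (x ⊗ₜ p) * (1 ⊗ₜ v) := rfl

theorem opl_mul (τ : X ⊗[k] P →ₗ[k] P ⊗[k] V) (x : X) (v : V) (Z : P ⊗[k] V) :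
    opl τ x (Z * (1 ⊗ₜ v)) = opl τ x Z * (1 ⊗ₜ v) := by
  induction Z with
  | zero => simp
  | add a b ha hb => simp only [add_mul, map_add, ha, hb]
  | tmul a b =>
    rw [Algebra.TensorProduct.tmul_mul_tmul, mul_one, opl_tmul, opl_tmul, mul_assoc,
      Algebra.TensorProduct.tmul_mul_tmul, one_mul]

/-- Moving an element of `V` past two elements of `P`, one after the other. -/
noncomputable def passTwo (τ : V ⊗[k] P →ₗ[k] P ⊗[k] V) :
    V ⊗[k] (P ⊗[k] P) →ₗ[k] (P ⊗[k] P) ⊗[k] V :=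
  (TensorProduct.assoc k P P V).symm.toLinearMap ∘ₗ τ.lTensor P ∘ₗ
    (TensorProduct.assoc k P V P).toLinearMap ∘ₗ τ.rTensor P ∘ₗ
    (TensorProduct.assoc k V P P).symm.toLinearMap

theorem passTwo_tmul (τ : V ⊗[k] P →ₗ[k] P ⊗[k] V) (v : V) (a b : P) :
    passTwo τ (v ⊗ₜ (a ⊗ₜ b)) = (TensorProduct.assoc k P P V).symm
      (τ.lTensor P (TensorProduct.assoc k P V P (τ (v ⊗ₜ a) ⊗ₜ b))) := rfl

/-- Moving `v : V` past the first factor of `P ⊗ V`. -/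
noncomputable def passLeftTensor (τ : V ⊗[k] P →ₗ[k] P ⊗[k] V) :
    V ⊗[k] (P ⊗[k] V) →ₗ[k] P ⊗[k] (V ⊗[k] V) :=
  (TensorProduct.assoc k P V V).toLinearMap ∘ₗ τ.rTensor V ∘ₗ
    (TensorProduct.assoc k V P V).symm.toLinearMap

theorem passLeftTensor_tmul (τ : V ⊗[k] P →ₗ[k] P ⊗[k] V) (v w : V) (p : P) :
    passLeftTensor τ (v ⊗ₜ (p ⊗ₜ w)) = TensorProduct.assoc k P V V (τ (v ⊗ₜ p) ⊗ₜ w) := rfl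

/-- Moving an element of `P` past two elements of `V`. -/
noncomputable def passPair (τ : V ⊗[k] P →ₗ[k] P ⊗[k] V) :
    (V ⊗[k] V) ⊗[k] P →ₗ[k] P ⊗[k] (V ⊗[k] V) :=
  passLeftTensor τ ∘ₗ τ.lTensor V ∘ₗ (TensorProduct.assoc k V V P).toLinearMap

theorem passPair_tmul (τ : V ⊗[k] P →ₗ[k] P ⊗[k] V) (v w : V) (p : P) :
    passPair τ ((v ⊗ₜ w) ⊗ₜ p) = passLeftTensor τ (v ⊗ₜ τ (w ⊗ₜ p)) := rfl

/-- Right multiplicativity for one letter of V gives it for a pair of letters. After p has crossed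
h, leaving a ⊗ b, the crossing of g with a and that of b with p' are independent and can be done in
either order. -/
theorem passPair_mul (τ : V ⊗[k] P →ₗ[k] P ⊗[k] V)
    (hτ : ∀ v p p', τ (v ⊗ₜ (p * p')) = opr τ p' (τ (v ⊗ₜ p))) (z : V ⊗[k] V) (p p' : P) :
    passPair τ (z ⊗ₜ (p * p')) = opr (passPair τ) p' (passPair τ (z ⊗ₜ p)) := by
  induction z with
  | zero => simp
  | add a b ha hb => simp only [add_tmul, map_add, ha, hb]
  | tmul g h =>
  rw [passPair_tmul, passPair_tmul, hτ]
  generalize τ (h ⊗ₜ p) = Y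
  induction Y with
  | zero => simp
  | add a b ha hb => simp only [tmul_add, map_add, ha, hb]
  | tmul a b =>
  -- The last crossing, which takes as input the two independent ones; both sides factor through it.
  let F : (P ⊗[k] V) ⊗[k] (P ⊗[k] V) →ₗ[k] P ⊗[k] (V ⊗[k] V) :=
    LinearMap.mul' k (P ⊗[k] (V ⊗[k] V)) ∘ₗ TensorProduct.map
      (Algebra.TensorProduct.includeLeft : P →ₐ[k] P ⊗[k] (V ⊗[k] V)).toLinearMap
      (passLeftTensor τ) ∘ₗ (TensorProduct.assoc k P V (P ⊗[k] V)).toLinearMap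
  have h1 : ∀ T : P ⊗[k] V, opr (passPair τ) p' (TensorProduct.assoc k P V V (T ⊗ₜ b)) =
      F (T ⊗ₜ τ (b ⊗ₜ p')) := by
    intro T
    induction T with
    | zero => simp
    | add a b ha hb => simp only [add_tmul, map_add, ha, hb]
    | tmul e f => simp [F, opr_tmul, passPair_tmul]
  have h2 : ∀ Z : P ⊗[k] V, passLeftTensor τ (g ⊗ₜ ((a ⊗ₜ 1) * Z)) = F (τ (g ⊗ₜ a) ⊗ₜ Z) := by
    intro Z
    induction Z with
    | zero => simp
    | add a b ha hb => simp only [tmul_add, mul_add, map_add, ha, hb]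
    | tmul c d =>
      rw [Algebra.TensorProduct.tmul_mul_tmul, one_mul, passLeftTensor_tmul, hτ]
      generalize τ (g ⊗ₜ a) = T
      induction T with
      | zero => simp
      | add a b ha hb => simp only [add_tmul, map_add, ha, hb]
      | tmul e f =>
        simp only [F, opr_tmul, LinearMap.comp_apply, LinearEquiv.coe_coe,
          TensorProduct.assoc_tmul, map_tmul, passLeftTensor_tmul, LinearMap.mul'_apply]
        generalize τ (f ⊗ₜ c) = S
        induction S with
        | zero => simp
        | add a b ha hb => simp only [add_tmul, mul_add, map_add, ha, hb]
        | tmul i j => simp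
  rw [opr_tmul, h2, passLeftTensor_tmul, h1]

end Operators

section Multiplicative

variable {U : Type*} [Ring U] [Algebra k U] {H : Type*} [Ring H] [Algebra k H]
  (R : H ⊗[k] U →ₗ[k] U ⊗[k] H)

/-- Multiplicativity as an operator identity, the form that composes along words;
`IsMultiplicative.of_opl_opr` leads back. -/
theorem map_tmul_mul_eq_opr [IsMultiplicative R] (h : H) (u u' : U) :
    R (h ⊗ₜ (u * u')) = opr R u' (R (h ⊗ₜ u)) := by
  rw [R_mul_right]
  induction R (h ⊗ₜ u) with
  | zero => simp
  | add a b ha hb => simp only [add_tmul, map_add, ha, hb]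
  | tmul a b =>
    rw [opr_tmul, TensorProduct.assoc_tmul, LinearMap.lTensor_tmul]
    induction R (b ⊗ₜ u') with
    | zero => simp
    | add a b ha hb => simp only [tmul_add, mul_add, map_add, ha, hb]
    | tmul a b => simp

theorem map_mul_tmul_eq_opl [IsMultiplicative R] (h h' : H) (u : U) :
    R ((h * h') ⊗ₜ u) = opl R h (R (h' ⊗ₜ u)) := by
  rw [R_mul_left]
  induction R (h' ⊗ₜ u) with
  | zero => simp
  | add a b ha hb => simp only [tmul_add, map_add, ha, hb]
  | tmul a b =>
    rw [opl_tmul, TensorProduct.assoc_symm_tmul, LinearMap.rTensor_tmul]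
    induction R (h ⊗ₜ a) with
    | zero => simp
    | add a b ha hb => simp only [add_tmul, add_mul, map_add, ha, hb]
    | tmul a b => simp

theorem IsMultiplicative.of_opl_opr
    (hl : ∀ h h' u, R ((h * h') ⊗ₜ u) = opl R h (R (h' ⊗ₜ u)))
    (hr : ∀ h u u', R (h ⊗ₜ (u * u')) = opr R u' (R (h ⊗ₜ u))) : IsMultiplicative R where
  left := by
    refine TensorProduct.ext_threefold fun h h' u => ?_
    simp only [LinearMap.comp_apply, LinearMap.rTensor_tmul, LinearMap.mul'_apply,
      LinearEquiv.coe_coe, TensorProduct.assoc_tmul, LinearMap.lTensor_tmul]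
    rw [hl]
    induction R (h' ⊗ₜ u) with
    | zero => simp
    | add a b ha hb => simp only [tmul_add, map_add, ha, hb]
    | tmul a b =>
      rw [opl_tmul, TensorProduct.assoc_symm_tmul, LinearMap.rTensor_tmul]
      induction R (h ⊗ₜ a) with
      | zero => simp
      | add a b ha hb => simp only [add_tmul, add_mul, map_add, ha, hb]
      | tmul a b => simp
  right := by
    refine TensorProduct.ext' fun h z => ?_
    induction z with
    | zero => simp
    | add a b ha hb => simp only [tmul_add, map_add, ha, hb]
    | tmul u u' =>
    simp only [LinearMap.comp_apply, LinearMap.rTensor_tmul, LinearMap.mul'_apply,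
      LinearEquiv.coe_coe, TensorProduct.assoc_symm_tmul, LinearMap.lTensor_tmul]
    rw [hr]
    induction R (h ⊗ₜ u) with
    | zero => simp
    | add a b ha hb => simp only [add_tmul, map_add, ha, hb]
    | tmul a b =>
      rw [opr_tmul, TensorProduct.assoc_tmul, LinearMap.lTensor_tmul]
      induction R (b ⊗ₜ u') with
      | zero => simp
      | add a b ha hb => simp only [tmul_add, mul_add, map_add, ha, hb]
      | tmul a b => simp

end Multiplicative

end Passing

/-! ### Crossing a₁ ⊗ S(a₂) when R is a coalgebra map. -/

section CoalgebraPassing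

open Coalgebra HopfAlgebra

variable {k : Type*} [Field k]
  {U : Type*} [Ring U] [HopfAlgebra k U] {H : Type*} [Ring H] [HopfAlgebra k H]
  (R : H ⊗[k] U →ₗ[k] U ⊗[k] H)

/-- The map `h ⊗ u ↦ h ▷ u = u^R ε(h^R)`. -/
noncomputable def actLeft : H ⊗[k] U →ₗ[k] U :=
  (TensorProduct.rid k U).toLinearMap ∘ₗ (counit (R := k) (A := H)).lTensor U ∘ₗ R

/-- The map `h ⊗ u ↦ h ◁ u = ε(u^R) h^R`. -/
noncomputable def actRight : H ⊗[k] U →ₗ[k] H :=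
  (TensorProduct.lid k H).toLinearMap ∘ₗ (counit (R := k) (A := U)).rTensor H ∘ₗ R

theorem sum_counit_smul_right {A : Type*} [AddCommGroup A] [Module k A] [Coalgebra k A] (a : A) :
    TensorProduct.rid k A ((counit (R := k) (A := A)).lTensor A (comul a)) = a := by
  simp

theorem sum_counit_smul_left {A : Type*} [AddCommGroup A] [Module k A] [Coalgebra k A] (a : A) :
    TensorProduct.lid k A ((counit (R := k) (A := A)).rTensor A (comul a)) = a := by
  simp

theorem map_comul_comp_map [IsCoalgMap R] {M : Type*} [AddCommGroup M] [Module k M]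
    (f : U ⊗[k] H →ₗ[k] M) (x : H ⊗[k] U) :
    TensorProduct.map (f ∘ₗ R) R (comul (R := k) x) =
      TensorProduct.map f LinearMap.id (comul (R := k) (R x)) := by
  rw [← LinearMap.comp_apply (comul (R := k)) R, ← IsCoalgMap.map_comp_comul,
    LinearMap.comp_apply, ← LinearMap.comp_apply (TensorProduct.map f LinearMap.id),
    ← TensorProduct.map_comp, LinearMap.id_comp]

/-- Comultiplicativity turns the left side into the comultiplication of R(x) with the first H-leg
killed by the counit, so only the U-component remains comultiplied. -/
theorem map_actLeft_comul [IsCoalgMap R] (x : H ⊗[k] U) :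
    TensorProduct.map (actLeft R) R (comul (R := k) x) =
      TensorProduct.assoc k U U H ((comul (R := k) (A := U)).rTensor H (R x)) := by
  rw [actLeft, ← LinearMap.comp_assoc, map_comul_comp_map]
  induction R x with
  | zero => simp
  | add a b ha hb => simp only [map_add, ha, hb]
  | tmul p q =>
    rw [TensorProduct.comul_tmul, LinearMap.rTensor_tmul]
    conv_rhs => rw [← sum_counit_smul_left (k := k) q]
    generalize comul (R := k) p = X
    generalize comul (R := k) q = Y
    induction X with
    | zero => simp
    | add a b ha hb => simp only [add_tmul, map_add, ha, hb]
    | tmul a b =>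
    induction Y with
    | zero => simp
    | add a b ha hb => simp only [tmul_add, map_add, ha, hb]
    | tmul c d => simp [smul_tmul']

theorem map_actRight_comul [IsCoalgMap R] (x : H ⊗[k] U) :
    TensorProduct.map (actRight R) R (comul (R := k) x) =
      TensorProduct.leftComm k U H H ((comul (R := k) (A := H)).lTensor U (R x)) := by
  rw [actRight, ← LinearMap.comp_assoc, map_comul_comp_map]
  induction R x with
  | zero => simp
  | add a b ha hb => simp only [map_add, ha, hb]
  | tmul p q =>
    rw [TensorProduct.comul_tmul, LinearMap.lTensor_tmul]
    conv_rhs => rw [← sum_counit_smul_left (k := k) p]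
    generalize comul (R := k) p = X
    generalize comul (R := k) q = Y
    induction X with
    | zero => simp
    | add a b ha hb => simp only [add_tmul, map_add, ha, hb]
    | tmul a b =>
    induction Y with
    | zero => simp
    | add a b ha hb => simp only [tmul_add, map_add, ha, hb]
    | tmul c d => simp [← smul_tmul']

variable [IsNormal R] [IsMultiplicative R] [IsCoalgMap R]

/-- For w = a ⊗ b, comultiplying the crossed letter a amounts to acting on a₁ by h₁ and crossing a₂
with h₂ (`map_actLeft_comul`). The successive crossings of a₂ and b then merge, by right
multiplicativity, into the crossing of a₂b. -/
theorem rTensor_canMap_passTwo (h : H) (w : U ⊗[k] U) :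
    (canMap k U).rTensor H (passTwo R (h ⊗ₜ w)) =
      (TensorProduct.assoc k U U H).symm (TensorProduct.map (actLeft R) R
        (AlgebraTensorModule.tensorTensorTensorComm k k k k H H U U
          (comul (R := k) h ⊗ₜ canMap k U w))) := by
  induction w with
  | zero => simp
  | add a b ha hb => simp only [tmul_add, map_add, ha, hb]
  | tmul a b =>
  have h1 : ∀ (X : H ⊗[k] H) (Y : U ⊗[k] U), TensorProduct.map (actLeft R) R
        (AlgebraTensorModule.tensorTensorTensorComm k k k k H H U U (X ⊗ₜ (Y * (1 ⊗ₜ b)))) =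
      (opr R b).lTensor U (TensorProduct.map (actLeft R) R
        (AlgebraTensorModule.tensorTensorTensorComm k k k k H H U U (X ⊗ₜ Y))) := by
    intro X Y
    induction X with
    | zero => simp
    | add a b ha hb => simp only [add_tmul, map_add, ha, hb]
    | tmul a b =>
    induction Y with
    | zero => simp
    | add a b ha hb => simp only [tmul_add, add_mul, map_add, ha, hb]
    | tmul c d => simp [map_tmul_mul_eq_opr]
  rw [canMap_tmul, h1, ← TensorProduct.comul_tmul, map_actLeft_comul, passTwo_tmul]
  induction R (h ⊗ₜ a) with
  | zero => simp
  | add a b ha hb => simp only [add_tmul, map_add, ha, hb]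
  | tmul p q =>
    rw [TensorProduct.assoc_tmul, LinearMap.lTensor_tmul, LinearMap.rTensor_tmul]
    have h2 : ∀ Z : U ⊗[k] H, (canMap k U).rTensor H
        ((TensorProduct.assoc k U U H).symm (p ⊗ₜ Z)) =
        (comul (R := k) p ⊗ₜ 1) * ((TensorProduct.assoc k U U H).symm (1 ⊗ₜ Z)) := by
      intro Z
      induction Z with
      | zero => simp
      | add a b ha hb => simp only [tmul_add, mul_add, map_add, ha, hb]
      | tmul c d => simp [canMap_tmul]
    rw [h2]
    induction comul (R := k) p with
    | zero => simp
    | add a b ha hb => simp only [add_tmul, add_mul, map_add, ha, hb]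
    | tmul c d =>
      rw [TensorProduct.assoc_tmul, LinearMap.lTensor_tmul, opr_tmul]
      induction R (q ⊗ₜ b) with
      | zero => simp
      | add a b ha hb => simp only [tmul_add, mul_add, map_add, ha, hb]
      | tmul c d => simp

/-- `a₁^R ⊗ S(a₂)^r ⊗ h^{Rr} = (h₁ ▷ a)₁ ⊗ S((h₁ ▷ a)₂) ⊗ h₂`. -/
theorem passTwo_twistedComul (h : H) (a : U) :
    passTwo R (h ⊗ₜ twistedComul k U a) = (twistedComul k U).rTensor H
      ((actLeft R ∘ₗ (TensorProduct.mk k H U).flip a).rTensor H (comul (R := k) h)) := by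
  have h0 : ∀ z : (U ⊗[k] U) ⊗[k] H,
      (canInv k U).rTensor H ((canMap k U).rTensor H z) = z := by
    intro z
    induction z with
    | zero => simp
    | add a b ha hb => simp only [map_add, ha, hb]
    | tmul a b => simp [canInv_canMap]
  -- After the canonical map the pair is a ⊗ 1, so the only genuine R left is R(h₂ ⊗ 1), trivial by
  -- normality.
  rw [← h0 (passTwo R _), rTensor_canMap_passTwo, canMap_twistedComul]
  induction comul (R := k) h with
  | zero => simp
  | add a b ha hb => simp only [add_tmul, map_add, ha, hb]
  | tmul x y => simp [IsNormal.left, canInv_tmul_one]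

/-- The map `(g ⊗ h) ⊗ u ↦ g ◁ (h ▷ u)`. -/
noncomputable def actPair : (H ⊗[k] H) ⊗[k] U →ₗ[k] H :=
  actRight R ∘ₗ (actLeft R).lTensor H ∘ₗ (TensorProduct.assoc k H H U).toLinearMap

/-- The map `(a ⊗ b) ⊗ (c ⊗ z) ↦ (a ◁ c) ⊗ b z`, where `b z` is given by `opl R`. -/
noncomputable def actPass : (H ⊗[k] H) ⊗[k] (U ⊗[k] (U ⊗[k] H)) →ₗ[k] H ⊗[k] (U ⊗[k] H) :=
  TensorProduct.map (actRight R) (TensorProduct.lift (opl R)) ∘ₗ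
    (AlgebraTensorModule.tensorTensorTensorComm k k k k H H U (U ⊗[k] H)).toLinearMap

theorem actPass_tmul (a b : H) (c : U) (z : U ⊗[k] H) :
    actPass R ((a ⊗ₜ b) ⊗ₜ (c ⊗ₜ z)) = actRight R (a ⊗ₜ c) ⊗ₜ opl R b z := rfl

/-- The outer half of the computation on the H side: comultiplying the crossed g splits the crossing
into g₁ ◁ p₁ and R(g₂ ⊗ p₂), by `map_actRight_comul`, while q is merely multiplied from the right.
-/
theorem lTensor_canMap_passLeftTensor (g : H) (X : U ⊗[k] H) :
    (canMap k H).lTensor U (passLeftTensor R (g ⊗ₜ X)) =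
      TensorProduct.leftComm k H U H (actPass R (comul (R := k) g ⊗ₜ
        (TensorProduct.assoc k U U H ((comul (R := k) (A := U)).rTensor H X)))) := by
  induction X with
  | zero => simp
  | add a b ha hb => simp only [tmul_add, map_add, ha, hb]
  | tmul p q =>
  have h2 : ∀ (X : H ⊗[k] H) (Y : U ⊗[k] U),
      actPass R (X ⊗ₜ TensorProduct.assoc k U U H (Y ⊗ₜ q)) =
      TensorProduct.map (actRight R) R
        (AlgebraTensorModule.tensorTensorTensorComm k k k k H H U U (X ⊗ₜ Y)) *
        (1 ⊗ₜ (1 ⊗ₜ q)) := by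
    intro X Y
    induction X with
    | zero => simp
    | add a b ha hb => simp only [add_tmul, add_mul, map_add, ha, hb]
    | tmul a b =>
    induction Y with
    | zero => simp
    | add a b ha hb => simp only [tmul_add, add_tmul, add_mul, map_add, ha, hb]
    | tmul c d => simp [actPass_tmul, opl_tmul]
  rw [LinearMap.rTensor_tmul, h2, ← TensorProduct.comul_tmul, map_actRight_comul,
    passLeftTensor_tmul]
  induction R (g ⊗ₜ p) with
  | zero => simp
  | add a b ha hb => simp only [add_tmul, add_mul, map_add, ha, hb]
  | tmul a b =>
    simp only [TensorProduct.assoc_tmul, LinearMap.lTensor_tmul, canMap_tmul]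
    induction comul (R := k) b with
    | zero => simp
    | add a b ha hb => simp only [tmul_add, add_mul, map_add, ha, hb]
    | tmul a b => simp

theorem actPass_map_actLeft (X Y : H ⊗[k] H) (Z : U ⊗[k] U) :
    actPass R (X ⊗ₜ TensorProduct.map (actLeft R) R
      (AlgebraTensorModule.tensorTensorTensorComm k k k k H H U U (Y ⊗ₜ Z))) =
    TensorProduct.map (actPair R) R
      (AlgebraTensorModule.tensorTensorTensorComm k k k k (H ⊗[k] H) H U U
        ((LinearMap.mul' k H).lTensor (H ⊗[k] H)
          (AlgebraTensorModule.tensorTensorTensorComm k k k k H H H H (X ⊗ₜ Y)) ⊗ₜ Z)) := by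
  induction Z with
  | zero => simp
  | add a b ha hb => simp only [tmul_add, map_add, ha, hb]
  | tmul e f =>
  induction Y with
  | zero => simp
  | add a b ha hb => simp only [tmul_add, add_tmul, map_add, ha, hb]
  | tmul c d =>
  induction X with
  | zero => simp
  | add a b ha hb => simp only [add_tmul, map_add, ha, hb]
  | tmul a b => simp [actPass_tmul, actPair, map_mul_tmul_eq_opl]

/-- Here u meets the second letter h first and g afterwards. The comultiplication on U produced at
the outer step is absorbed by `map_actLeft_comul`, and left multiplicativity fuses the crossings of
h₂ and g₂ into that of g₂h₂, which is why `comulMul` appears. -/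
theorem lTensor_canMap_passPair (z : H ⊗[k] H) (u : U) :
    (canMap k H).lTensor U (passPair R (z ⊗ₜ u)) =
      TensorProduct.leftComm k H U H (TensorProduct.map (actPair R) R
        (AlgebraTensorModule.tensorTensorTensorComm k k k k (H ⊗[k] H) H U U
          (comulMul k H z ⊗ₜ comul (R := k) u))) := by
  induction z with
  | zero => simp
  | add a b ha hb => simp only [add_tmul, map_add, ha, hb]
  | tmul g h =>
  have h3 : comulMul k H (g ⊗ₜ h) = (LinearMap.mul' k H).lTensor (H ⊗[k] H)
      (AlgebraTensorModule.tensorTensorTensorComm k k k k H H H H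
        (comul (R := k) g ⊗ₜ comul (R := k) h)) := by
    rw [comulMul, LinearMap.comp_apply, TensorProduct.comul_tmul]
  rw [passPair_tmul, lTensor_canMap_passLeftTensor, ← map_actLeft_comul, TensorProduct.comul_tmul,
    actPass_map_actLeft, h3]

/-- The map `h ⊗ u ↦ u₂ ⊗ h₁ ◁ (S(h₂) ▷ u₁)`. -/
noncomputable def conjMap : H ⊗[k] U →ₗ[k] U ⊗[k] H :=
  (TensorProduct.comm k H U).toLinearMap ∘ₗ (actPair R).rTensor U ∘ₗ
    (TensorProduct.assoc k (H ⊗[k] H) U U).symm.toLinearMap ∘ₗ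
    TensorProduct.map (twistedComul k H) comul

/-- Moving `u` past `h₁ ⊗ S(h₂)`. -/
theorem passPair_twistedComul (h : H) (u : U) :
    passPair R (twistedComul k H h ⊗ₜ u) =
      (twistedComul k H).lTensor U (conjMap R (h ⊗ₜ u)) := by
  have h0 : ∀ z : U ⊗[k] (H ⊗[k] H),
      (canInv k H).lTensor U ((canMap k H).lTensor U z) = z := by
    intro z
    induction z with
    | zero => simp
    | add a b ha hb => simp only [map_add, ha, hb]
    | tmul a b => simp [canInv_canMap]
  -- The fused letter h₂S(h₃) collapses to 1, so u₂ crosses it trivially by normality.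
  rw [← h0 (passPair R _), lTensor_canMap_passPair, comulMul_twistedComul, conjMap]
  simp only [LinearMap.comp_apply, map_tmul]
  induction comul (R := k) u with
  | zero => simp
  | add a b ha hb => simp only [tmul_add, map_add, ha, hb]
  | tmul x y => simp [IsNormal.right, canInv_tmul_one]

/-- Inherited from `passPair_mul` through h ↦ h₁ ⊗ S(h₂), which can be cancelled: it has id ⊗ ε as a
retraction because ε ∘ S = ε. -/
theorem conjMap_mul (h : H) (u u' : U) :
    conjMap R (h ⊗ₜ (u * u')) = opr (conjMap R) u' (conjMap R (h ⊗ₜ u)) := by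
  let r : H ⊗[k] H →ₗ[k] H :=
    (TensorProduct.rid k H).toLinearMap ∘ₗ (counit (R := k) (A := H)).lTensor H
  have hr : ∀ x : H, r (twistedComul k H x) = x := by
    intro x
    conv_rhs => rw [← sum_counit_smul_right (k := k) x]
    change r ((antipode k).lTensor H (comul x)) = _
    induction comul (R := k) x with
    | zero => simp
    | add a b ha hb => simp only [map_add, ha, hb]
    | tmul a b => simp [r]
  have h0 : ∀ z : U ⊗[k] H, r.lTensor U ((twistedComul k H).lTensor U z) = z := by
    intro z
    induction z with
    | zero => simp
    | add a b ha hb => simp only [map_add, ha, hb]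
    | tmul a b => simp [hr]
  rw [← h0 (conjMap R _), ← passPair_twistedComul, passPair_mul R (map_tmul_mul_eq_opr R),
    passPair_twistedComul]
  conv_rhs => rw [← h0 (opr _ _ _)]
  congr 1
  induction conjMap R (h ⊗ₜ u) with
  | zero => simp
  | add a b ha hb => simp only [map_add, ha, hb]
  | tmul a b =>
    rw [LinearMap.lTensor_tmul, opr_tmul, opr_tmul, passPair_twistedComul]
    induction conjMap R (b ⊗ₜ u') with
    | zero => simp
    | add a b ha hb => simp only [mul_add, map_add, ha, hb]
    | tmul a b => simp

/-- `u₁ ⊗ conjMap(h ⊗ S(u₂)) = u₁ ⊗ S(u₂) ⊗ h₁ ◁ (S(h₂) ▷ S(u₃))`. -/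
theorem lTensor_conjMap_twistedComul (h : H) (u : U) :
    (conjMap R ∘ₗ TensorProduct.mk k H U h).lTensor U (twistedComul k U u) =
      TensorProduct.assoc k U U H (TensorProduct.map (twistedComul k U)
        (actPair R ∘ₗ TensorProduct.mk k (H ⊗[k] H) U (twistedComul k H h) ∘ₗ antipode k)
        (comul (R := k) u)) := by
  let f : U →ₗ[k] H := actPair R ∘ₗ TensorProduct.mk k (H ⊗[k] H) U (twistedComul k H h)
  have h1 : ∀ z : U ⊗[k] U, (conjMap R ∘ₗ TensorProduct.mk k H U h).lTensor U z =
      (f.lTensor U).lTensor U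
        (((TensorProduct.comm k U U).toLinearMap ∘ₗ comul).lTensor U z) := by
    intro z
    induction z with
    | zero => simp
    | add a b ha hb => simp only [map_add, ha, hb]
    | tmul a b =>
      simp only [LinearMap.lTensor_tmul, LinearMap.comp_apply, mk_apply, conjMap, map_tmul]
      induction comul (R := k) b with
      | zero => simp
      | add a b ha hb => simp only [tmul_add, map_add, ha, hb]
      | tmul a b => simp [f]
  -- `conjMap` comultiplies S(u₂) and takes the legs in swapped order; S reverses Δ, so the legs
  -- come out as S(u₂) and S(u₃).
  rw [h1, lTensor_comm_comul_antipode]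
  induction comul (R := k) u with
  | zero => simp
  | add a b ha hb => simp only [map_add, ha, hb]
  | tmul a b =>
    simp only [map_tmul]
    induction twistedComul k U a with
    | zero => simp
    | add a b ha hb => simp only [add_tmul, map_add, ha, hb]
    | tmul a b => simp [f]

end CoalgebraPassing

end PartialHopf

namespace PartialHopf

/-! ### Partial representations via `twistedComul`, and the universal property of A_par. -/

section ParLift

open Coalgebra HopfAlgebra

variable {k : Type*} [Field k] {A : Type*} [Ring A] [HopfAlgebra k A]
  {B : Type*} [Ring B] [Algebra k B]

/-- The linear map `x ⊗ y ↦ π(x) π(y)`. -/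
noncomputable def mulPair {V : Type*} [AddCommGroup V] [Module k V] (π : V →ₗ[k] B) :
    V ⊗[k] V →ₗ[k] B :=
  LinearMap.mul' k B ∘ₗ TensorProduct.map π π

theorem mulPair_tmul {V : Type*} [AddCommGroup V] [Module k V] (π : V →ₗ[k] B) (x y : V) :
    mulPair π (x ⊗ₜ y) = π x * π y := rfl

theorem mulPair_twistedComul (π : A →ₗ[k] B) (a : A) :
    mulPair π (twistedComul k A a) =
      LinearMap.mul' k B (TensorProduct.map π (π ∘ₗ antipode k) (comul (R := k) a)) := by
  rw [mulPair, twistedComul, LinearMap.comp_apply, LinearMap.comp_apply]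
  induction comul (R := k) a with
  | zero => simp
  | add a b ha hb => simp only [map_add, ha, hb]
  | tmul x y => simp

theorem mulPair_mul_twistedComul (π : A →ₗ[k] B) (h a : A) :
    mulPair π ((h ⊗ₜ 1) * twistedComul k A a) =
      LinearMap.mul' k B (TensorProduct.map (π ∘ₗ LinearMap.mulLeft k h) (π ∘ₗ antipode k)
        (comul (R := k) a)) := by
  rw [mulPair, twistedComul, LinearMap.comp_apply, LinearMap.comp_apply]
  induction comul (R := k) a with
  | zero => simp
  | add a b ha hb => simp only [map_add, mul_add, ha, hb]
  | tmul x y => simp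

theorem mulPair_twistedComul_mul (π : A →ₗ[k] B) (a h : A) :
    mulPair π (twistedComul k A a * (1 ⊗ₜ h)) =
      LinearMap.mul' k B (TensorProduct.map π (π ∘ₗ LinearMap.mulRight k h ∘ₗ antipode k)
        (comul (R := k) a)) := by
  rw [mulPair, twistedComul, LinearMap.comp_apply, LinearMap.comp_apply]
  induction comul (R := k) a with
  | zero => simp
  | add a b ha hb => simp only [map_add, add_mul, ha, hb]
  | tmul x y => simp

/-- This form refers to Δ and S only through a₁ ⊗ S(a₂), so the crossing formulas can be substituted
directly. -/
theorem isPartialRep_iff {π : A →ₗ[k] B} : IsPartialRep π ↔ π 1 = 1 ∧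
    (∀ h a, π h * mulPair π (twistedComul k A a) =
      mulPair π ((h ⊗ₜ 1) * twistedComul k A a)) ∧
    (∀ a h, mulPair π (twistedComul k A a) * π h =
      mulPair π (twistedComul k A a * (1 ⊗ₜ h))) := by
  simp only [mulPair_twistedComul, mulPair_mul_twistedComul, mulPair_twistedComul_mul]
  exact ⟨fun h => ⟨h.map_one, h.mul_left, h.mul_right⟩, fun h => ⟨h.1, h.2.1, h.2.2⟩⟩

variable (k A) in
/-- The map `a ↦ [a]`. -/
noncomputable def Par.ι : A →ₗ[k] Par k A := (Par.proj k A).toLinearMap ∘ₗ TensorAlgebra.ι k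

theorem Par.proj_ι (a : A) : Par.proj k A (TensorAlgebra.ι k a) = Par.ι k A a := rfl

theorem algHom_mul'_map {V W A' : Type*} [AddCommGroup V] [Module k V] [AddCommGroup W] [Module k W]
    [Ring A'] [Algebra k A'] (φ : A' →ₐ[k] B) (f : V →ₗ[k] A') (g : W →ₗ[k] A') (z : V ⊗[k] W) :
    φ (LinearMap.mul' k A' (TensorProduct.map f g z)) =
      LinearMap.mul' k B (TensorProduct.map (φ.toLinearMap ∘ₗ f) (φ.toLinearMap ∘ₗ g) z) := by
  induction z with
  | zero => simp
  | add a b ha hb => simp only [map_add, ha, hb]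
  | tmul x y => simp

theorem Par.proj_surjective : Function.Surjective (Par.proj k A) :=
  RingQuot.mkAlgHom_surjective k (ParRel k A)

variable (k A) in
theorem Par.isPartialRep_ι : IsPartialRep (Par.ι k A) where
  map_one := by
    have := RingQuot.mkAlgHom_rel k (ParRel.one (k := k) (A := A))
    change Par.proj k A _ = Par.proj k A _ at this
    rwa [map_one (Par.proj k A)] at this
  mul_left h a := by
    have := RingQuot.mkAlgHom_rel k (ParRel.mul_left (k := k) h a)
    change Par.proj k A _ = Par.proj k A _ at this
    rw [map_mul, algHom_mul'_map, algHom_mul'_map] at this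
    exact this
  mul_right a h := by
    have := RingQuot.mkAlgHom_rel k (ParRel.mul_right (k := k) a h)
    change Par.proj k A _ = Par.proj k A _ at this
    rw [map_mul, algHom_mul'_map, algHom_mul'_map] at this
    exact this

/-- The algebra map on `A_par` induced by a partial representation. -/
noncomputable def Par.lift (π : A →ₗ[k] B) (hπ : IsPartialRep π) : Par k A →ₐ[k] B :=
  RingQuot.liftAlgHom k ⟨TensorAlgebra.lift k π, fun x y hxy => by
    have e : (TensorAlgebra.lift k π).toLinearMap ∘ₗ TensorAlgebra.ι k = π := by
      ext a
      simp
    have e' : ∀ f : A →ₗ[k] A, (TensorAlgebra.lift k π).toLinearMap ∘ₗ TensorAlgebra.ι k ∘ₗ f =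
        π ∘ₗ f := by
      intro f
      rw [← LinearMap.comp_assoc, e]
    cases hxy with
    | one => simpa using hπ.map_one
    | mul_left h a =>
      rw [map_mul, algHom_mul'_map, algHom_mul'_map, e, e', e', TensorAlgebra.lift_ι_apply]
      exact hπ.mul_left h a
    | mul_right a h =>
      rw [map_mul, algHom_mul'_map, algHom_mul'_map, e, e', e', TensorAlgebra.lift_ι_apply]
      exact hπ.mul_right a h⟩

theorem Par.lift_ι (π : A →ₗ[k] B) (hπ : IsPartialRep π) (a : A) :
    Par.lift π hπ (Par.ι k A a) = π a := by
  rw [Par.lift, ← Par.proj_ι]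
  exact (RingQuot.liftAlgHom_mkAlgHom_apply ..).trans (by simp)

theorem Par.induction {p : Par k A → Prop} (hι : ∀ a, p (Par.ι k A a))
    (halg : ∀ c : k, p (algebraMap k _ c)) (hmul : ∀ x y, p x → p y → p (x * y))
    (hadd : ∀ x y, p x → p y → p (x + y)) (x : Par k A) : p x := by
  obtain ⟨x, rfl⟩ := Par.proj_surjective x
  induction x using TensorAlgebra.induction with
  | algebraMap c => rw [AlgHom.commutes]; exact halg c
  | ι a => exact hι a
  | mul x y hx hy => rw [map_mul]; exact hmul _ _ hx hy
  | add x y hx hy => rw [map_add]; exact hadd _ _ hx hy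

theorem Par.algHom_ext {f g : Par k A →ₐ[k] B}
    (h : f.toLinearMap ∘ₗ Par.ι k A = g.toLinearMap ∘ₗ Par.ι k A) : f = g := by
  ext x
  induction x using Par.induction with
  | hι a => exact LinearMap.congr_fun h a
  | halg c => simp
  | hmul x y hx hy => rw [map_mul, map_mul, hx, hy]
  | hadd x y hx hy => rw [map_add, map_add, hx, hy]

theorem IsPartialRep.algHom_comp {B' : Type*} [Ring B'] [Algebra k B'] {π : A →ₗ[k] B}
    (hπ : IsPartialRep π) (f : B →ₐ[k] B') : IsPartialRep (f.toLinearMap ∘ₗ π) where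
  map_one := by simp [hπ.map_one]
  mul_left h a := by
    have := congrArg f (hπ.mul_left h a)
    rw [map_mul, algHom_mul'_map, algHom_mul'_map] at this
    exact this
  mul_right a h := by
    have := congrArg f (hπ.mul_right a h)
    rw [map_mul, algHom_mul'_map, algHom_mul'_map] at this
    exact this

end ParLift

/-! ### Commutation of left and right crossings. -/

section Commutation

variable {k : Type*} [Field k] {P : Type*} [Ring P] [Algebra k P] {V : Type*} [Ring V] [Algebra k V]

/-- On p ⊗ q both composites depend only on τ(g ⊗ p) and τ(q ⊗ t), through the same bilinear map
`F`, which crosses what is left of g with what is left of t. The hypotheses concern this g and this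
t alone, so the lemma applies inside an induction where one multiplicativity is known only for a
subword. -/
theorem opl_opr_comm (τ : V ⊗[k] P →ₗ[k] P ⊗[k] V) {g : V} {t : P}
    (hg : ∀ p c, τ (g ⊗ₜ (p * c)) = opr τ c (τ (g ⊗ₜ p)))
    (ht : ∀ s q, τ ((s * q) ⊗ₜ t) = opl τ s (τ (q ⊗ₜ t))) (Z : P ⊗[k] V) :
    opl τ g (opr τ t Z) = opr τ t (opl τ g Z) := by
  induction Z with
  | zero => simp
  | add a b ha hb => simp only [map_add, ha, hb]
  | tmul p q =>
  let F : (P ⊗[k] V) ⊗[k] (P ⊗[k] V) →ₗ[k] P ⊗[k] V :=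
    LinearMap.mul' k (P ⊗[k] V) ∘ₗ TensorProduct.map
      (Algebra.TensorProduct.includeLeft : P →ₐ[k] P ⊗[k] V).toLinearMap
      (TensorProduct.lift (opl τ)) ∘ₗ (TensorProduct.assoc k P V (P ⊗[k] V)).toLinearMap
  have hF : ∀ r s S, F ((r ⊗ₜ s) ⊗ₜ S) = (r ⊗ₜ 1) * opl τ s S := fun _ _ _ => rfl
  have h1 : ∀ S : P ⊗[k] V, opl τ g ((p ⊗ₜ 1) * S) = F (τ (g ⊗ₜ p) ⊗ₜ S) := by
    intro S
    induction S with
    | zero => simp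
    | add a b ha hb => simp only [tmul_add, mul_add, map_add, ha, hb]
    | tmul c d =>
      rw [Algebra.TensorProduct.tmul_mul_tmul, one_mul, opl_tmul, hg]
      induction τ (g ⊗ₜ p) with
      | zero => simp
      | add a b ha hb => simp only [add_tmul, add_mul, map_add, ha, hb]
      | tmul r s => rw [hF, opl_tmul, opr_tmul, mul_assoc]
  have h2 : ∀ S : P ⊗[k] V, opr τ t (S * (1 ⊗ₜ q)) = F (S ⊗ₜ τ (q ⊗ₜ t)) := by
    intro S
    induction S with
    | zero => simp
    | add a b ha hb => simp only [add_tmul, add_mul, map_add, ha, hb]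
    | tmul c d => rw [Algebra.TensorProduct.tmul_mul_tmul, mul_one, opr_tmul, ht, hF]
  rw [opr_tmul, h1, opl_tmul, h2]

end Commutation

/-! ### First stage: a letter of H crosses words in U_par. -/

section LetterPassing

open Coalgebra HopfAlgebra

variable {k : Type*} [Field k]
  {U : Type*} [Ring U] [HopfAlgebra k U] {H : Type*} [Ring H] [HopfAlgebra k H]
  (R : H ⊗[k] U →ₗ[k] U ⊗[k] H) [IsNormal R] [IsMultiplicative R] [IsCoalgMap R]

/-- By right multiplicativity v can be crossed first and multiplied into the first leg afterwards;
`passTwo_mul_right` is the same for the second leg, crossed last. -/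
theorem passTwo_mul_left (h : H) (v : U) (w : U ⊗[k] U) :
    passTwo R (h ⊗ₜ ((v ⊗ₜ 1) * w)) =
      opr (passTwo R) w ((tinl k U).toLinearMap.rTensor H (R (h ⊗ₜ v))) := by
  induction w with
  | zero => simp
  | add a b ha hb => simp only [mul_add, tmul_add, map_add, ha, hb, LinearMap.add_apply]
  | tmul a b =>
  rw [Algebra.TensorProduct.tmul_mul_tmul, one_mul, passTwo_tmul, map_tmul_mul_eq_opr]
  induction R (h ⊗ₜ v) with
  | zero => simp
  | add a b ha hb => simp only [add_tmul, map_add, ha, hb]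
  | tmul p q =>
  rw [LinearMap.rTensor_tmul, opr_tmul, opr_tmul, passTwo_tmul]
  induction R (q ⊗ₜ a) with
  | zero => simp
  | add a b ha hb => simp only [mul_add, add_tmul, map_add, ha, hb]
  | tmul c d =>
  rw [Algebra.TensorProduct.tmul_mul_tmul, one_mul, TensorProduct.assoc_tmul,
    TensorProduct.assoc_tmul, LinearMap.lTensor_tmul, LinearMap.lTensor_tmul]
  induction R (d ⊗ₜ b) with
  | zero => simp
  | add a b ha hb => simp only [mul_add, tmul_add, map_add, ha, hb]
  | tmul c d => simp

theorem passTwo_mul_right (h : H) (v : U) (w : U ⊗[k] U) :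
    passTwo R (h ⊗ₜ (w * (1 ⊗ₜ v))) =
      opr ((tinr k U).toLinearMap.rTensor H ∘ₗ R) v (passTwo R (h ⊗ₜ w)) := by
  induction w with
  | zero => simp
  | add a b ha hb => simp only [add_mul, tmul_add, map_add, ha, hb]
  | tmul a b =>
  rw [Algebra.TensorProduct.tmul_mul_tmul, mul_one, passTwo_tmul, passTwo_tmul]
  induction R (h ⊗ₜ a) with
  | zero => simp
  | add a b ha hb => simp only [add_tmul, map_add, ha, hb]
  | tmul p q =>
  rw [TensorProduct.assoc_tmul, TensorProduct.assoc_tmul, LinearMap.lTensor_tmul,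
    LinearMap.lTensor_tmul, map_tmul_mul_eq_opr]
  induction R (q ⊗ₜ b) with
  | zero => simp
  | add a b ha hb => simp only [tmul_add, map_add, ha, hb]
  | tmul c d =>
  rw [TensorProduct.assoc_symm_tmul, opr_tmul, opr_tmul, LinearMap.comp_apply]
  induction R (d ⊗ₜ v) with
  | zero => simp
  | add a b ha hb => simp only [mul_add, tmul_add, map_add, ha, hb]
  | tmul c d => simp

/-- The map `u ↦ (t ⊗ h ↦ t [u^R] ⊗ h^R)` with values in the opposite of the endomorphism
algebra. -/
noncomputable def letterPass : U →ₗ[k] (Module.End k (Par k U ⊗[k] H))ᵐᵒᵖ :=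
  (MulOpposite.opLinearEquiv k).toLinearMap ∘ₗ opr ((Par.ι k U).rTensor H ∘ₗ R)

theorem unop_letterPass (u : U) :
    (letterPass R u).unop = opr ((Par.ι k U).rTensor H ∘ₗ R) u := rfl

theorem unop_mulPair_letterPass (w : U ⊗[k] U) (p : Par k U) (h : H) :
    (mulPair (letterPass R) w).unop (p ⊗ₜ h) =
      (p ⊗ₜ 1) * (mulPair (Par.ι k U)).rTensor H (passTwo R (h ⊗ₜ w)) := by
  induction w with
  | zero => simp
  | add a b ha hb =>
    simp only [mul_add, tmul_add, map_add, MulOpposite.unop_add, LinearMap.add_apply, ha, hb]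
  | tmul a b =>
  rw [mulPair_tmul, MulOpposite.unop_mul, Module.End.mul_apply, unop_letterPass, unop_letterPass,
    opr_tmul, opr_mul, passTwo_tmul, LinearMap.comp_apply]
  congr 1
  induction R (h ⊗ₜ a) with
  | zero => simp
  | add a b ha hb => simp only [add_tmul, map_add, ha, hb]
  | tmul p q =>
  rw [TensorProduct.assoc_tmul, LinearMap.lTensor_tmul, LinearMap.rTensor_tmul, opr_tmul,
    LinearMap.comp_apply]
  induction R (q ⊗ₜ b) with
  | zero => simp
  | add a b ha hb => simp only [mul_add, tmul_add, map_add, ha, hb]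
  | tmul c d => simp [mulPair_tmul]

/-- By `passTwo_twistedComul`, crossing a₁ ⊗ S(a₂) leaves elements x₁ ⊗ S(x₂), to which the
relations of U_par apply. The opposite algebra is needed because the first letter of a word in U is
crossed first. -/
theorem isPartialRep_letterPass : IsPartialRep (letterPass R) := by
  have hι := isPartialRep_iff.mp (Par.isPartialRep_ι k U)
  refine isPartialRep_iff.mpr ⟨?_, fun v a => ?_, fun a v => ?_⟩
  · refine MulOpposite.unop_injective (TensorProduct.ext' fun p h => ?_)
    rw [unop_letterPass, opr_tmul, LinearMap.comp_apply, IsNormal.left]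
    simp [hι.1]
  · refine MulOpposite.unop_injective (TensorProduct.ext' fun p h => ?_)
    rw [unop_mulPair_letterPass, MulOpposite.unop_mul, Module.End.mul_apply, unop_letterPass,
      opr_tmul, passTwo_mul_left, LinearMap.comp_apply]
    induction R (h ⊗ₜ v) with
    | zero => simp
    | add a b ha hb => simp only [mul_add, map_add, ha, hb]
    | tmul q y =>
    rw [LinearMap.rTensor_tmul, LinearMap.rTensor_tmul, opr_tmul,
      Algebra.TensorProduct.tmul_mul_tmul, one_mul, unop_mulPair_letterPass, passTwo_twistedComul]
    generalize (actLeft R ∘ₗ (TensorProduct.mk k H U).flip a).rTensor H (comul (R := k) y) = E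
    induction E with
    | zero => simp
    | add a b ha hb => simp only [mul_add, map_add, ha, hb]
    | tmul x y =>
      have := hι.2.1 q x
      simp [mul_assoc, this]
  · refine MulOpposite.unop_injective (TensorProduct.ext' fun p h => ?_)
    rw [MulOpposite.unop_mul, Module.End.mul_apply, unop_letterPass, unop_mulPair_letterPass,
      unop_mulPair_letterPass, opr_mul, passTwo_mul_right, passTwo_twistedComul]
    congr 1
    generalize (actLeft R ∘ₗ (TensorProduct.mk k H U).flip a).rTensor H (comul (R := k) h) = E
    induction E with
    | zero => simp
    | add a b ha hb => simp only [map_add, ha, hb]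
    | tmul x y =>
    rw [LinearMap.rTensor_tmul, LinearMap.rTensor_tmul, opr_tmul, opr_tmul, LinearMap.comp_apply,
      LinearMap.comp_apply]
    induction R (y ⊗ₜ v) with
    | zero => simp
    | add a b ha hb => simp only [mul_add, map_add, ha, hb]
    | tmul c d =>
      have := hι.2.2 x c
      simp [this]

/-- The map `H ⊗ U_par → U_par ⊗ H`, `h ⊗ [u₁] ⋯ [uₘ] ↦ [u₁^{R₁}] ⋯ [uₘ^{Rₘ}] ⊗ h^{R₁ ⋯ Rₘ}`. -/
noncomputable def parPass : H ⊗[k] Par k U →ₗ[k] Par k U ⊗[k] H :=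
  TensorProduct.lift (((MulOpposite.opLinearEquiv k).symm.toLinearMap ∘ₗ
    (Par.lift (letterPass R) (isPartialRep_letterPass R)).toLinearMap).compl₂
      (TensorProduct.mk k (Par k U) H 1)).flip

theorem parPass_tmul (h : H) (t : Par k U) : parPass R (h ⊗ₜ t) =
    (Par.lift (letterPass R) (isPartialRep_letterPass R) t).unop (1 ⊗ₜ h) := rfl

/-- All these operators commute with left multiplication by U_par, so they are determined by their
values on 1 ⊗ h, which are `parPass`. -/
theorem unop_lift_letterPass (t : Par k U) :
    (Par.lift (letterPass R) (isPartialRep_letterPass R) t).unop = opr (parPass R) t := by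
  have h : ∀ (p : Par k U) (Z : Par k U ⊗[k] H),
      (Par.lift (letterPass R) (isPartialRep_letterPass R) t).unop ((p ⊗ₜ 1) * Z) =
      (p ⊗ₜ 1) * (Par.lift (letterPass R) (isPartialRep_letterPass R) t).unop Z := by
    induction t using Par.induction with
    | hι a =>
      intro p Z
      rw [Par.lift_ι, unop_letterPass, opr_mul]
    | halg c =>
      intro p Z
      simp [Algebra.algebraMap_eq_smul_one]
    | hmul x y hx hy =>
      intro p Z
      rw [map_mul (Par.lift _ _), MulOpposite.unop_mul, Module.End.mul_apply,
        Module.End.mul_apply, hx, hy]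
    | hadd x y hx hy =>
      intro p Z
      rw [map_add, MulOpposite.unop_add, LinearMap.add_apply, LinearMap.add_apply, hx, hy, mul_add]
  refine TensorProduct.ext' fun p v => ?_
  rw [opr_tmul, parPass_tmul, ← h, Algebra.TensorProduct.tmul_mul_tmul, one_mul, mul_one]

theorem parPass_mul (h : H) (t t' : Par k U) :
    parPass R (h ⊗ₜ (t * t')) = opr (parPass R) t' (parPass R (h ⊗ₜ t)) := by
  rw [parPass_tmul, map_mul, MulOpposite.unop_mul, Module.End.mul_apply, ← parPass_tmul,
    unop_lift_letterPass]

theorem opr_parPass_mul (t t' : Par k U) :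
    opr (parPass R) (t * t') = opr (parPass R) t' * opr (parPass R) t := by
  simp only [← unop_lift_letterPass, map_mul, MulOpposite.unop_mul]

theorem parPass_ι (h : H) (u : U) :
    parPass R (h ⊗ₜ Par.ι k U u) = (Par.ι k U).rTensor H (R (h ⊗ₜ u)) := by
  rw [parPass_tmul, Par.lift_ι, unop_letterPass, opr_tmul, ← Algebra.TensorProduct.one_def, one_mul]
  rfl

theorem parPass_one (h : H) : parPass R (h ⊗ₜ 1) = 1 ⊗ₜ h := by
  rw [parPass_tmul, map_one]
  rfl

theorem parPass_algebraMap (h : H) (c : k) :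
    parPass R (h ⊗ₜ algebraMap k _ c) = c • (1 ⊗ₜ h) := by
  rw [Algebra.algebraMap_eq_smul_one, tmul_smul, map_smul, parPass_one]

theorem parPass_one_tmul (t : Par k U) : parPass R (1 ⊗ₜ t) = t ⊗ₜ 1 := by
  induction t using Par.induction with
  | hι a => rw [parPass_ι, IsNormal.right, LinearMap.rTensor_tmul]
  | halg c => rw [parPass_algebraMap, Algebra.algebraMap_eq_smul_one, smul_tmul']
  | hmul x y hx hy =>
    rw [parPass_mul, hx, opr_tmul, hy, Algebra.TensorProduct.tmul_mul_tmul, one_mul]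
  | hadd x y hx hy => rw [tmul_add, map_add, hx, hy, add_tmul]

theorem parPass_mul_tmul (g h : H) (t : Par k U) :
    parPass R ((g * h) ⊗ₜ t) = opl (parPass R) g (parPass R (h ⊗ₜ t)) := by
  induction t using Par.induction generalizing g h with
  | hι a =>
    rw [parPass_ι, parPass_ι, map_mul_tmul_eq_opl]
    induction R (h ⊗ₜ a) with
    | zero => simp
    | add a b ha hb => simp only [map_add, ha, hb]
    | tmul p q =>
    rw [LinearMap.rTensor_tmul, opl_tmul, opl_tmul, parPass_ι]
    induction R (g ⊗ₜ p) with
    | zero => simp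
    | add a b ha hb => simp only [map_add, add_mul, ha, hb]
    | tmul p q => simp
  | halg c =>
    rw [parPass_algebraMap, parPass_algebraMap, map_smul, opl_tmul, parPass_one,
      Algebra.TensorProduct.tmul_mul_tmul, one_mul]
  -- Right multiplicativity is already known for all words; left multiplicativity is used for y
  -- only, which is the induction hypothesis.
  | hmul x y hx hy => rw [parPass_mul, parPass_mul, hx, opl_opr_comm _ (parPass_mul R g) hy]
  | hadd x y hx hy => simp only [tmul_add, map_add, hx, hy]

theorem passPair_parPass_ι (z : H ⊗[k] H) (u : U) :
    passPair (parPass R) (z ⊗ₜ Par.ι k U u) =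
      (Par.ι k U).rTensor (H ⊗[k] H) (passPair R (z ⊗ₜ u)) := by
  induction z with
  | zero => simp
  | add a b ha hb => simp only [add_tmul, map_add, ha, hb]
  | tmul g h =>
  rw [passPair_tmul, passPair_tmul, parPass_ι]
  induction R (h ⊗ₜ u) with
  | zero => simp
  | add a b ha hb => simp only [tmul_add, map_add, ha, hb]
  | tmul p q =>
  rw [LinearMap.rTensor_tmul, passLeftTensor_tmul, passLeftTensor_tmul, parPass_ι]
  induction R (g ⊗ₜ p) with
  | zero => simp
  | add a b ha hb => simp only [add_tmul, map_add, ha, hb]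
  | tmul p q => simp

theorem passPair_one (z : H ⊗[k] H) : passPair (parPass R) (z ⊗ₜ 1) = 1 ⊗ₜ z := by
  induction z with
  | zero => simp
  | add a b ha hb => simp only [add_tmul, tmul_add, map_add, ha, hb]
  | tmul g h =>
    rw [passPair_tmul, parPass_one, passLeftTensor_tmul, parPass_one, TensorProduct.assoc_tmul]

/-- The span of the elements p ⊗ x₁ ⊗ S(x₂) is stable under crossing further letters, each by
`conjMap`. Membership is all that is needed later, so no explicit map on words is constructed. -/
theorem exists_passPair_twistedComul (h : H) (t : Par k U) :
    ∃ y : Par k U ⊗[k] H, passPair (parPass R) (twistedComul k H h ⊗ₜ t) =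
      (twistedComul k H).lTensor (Par k U) y := by
  induction t using Par.induction generalizing h with
  | hι u =>
    refine ⟨(Par.ι k U).rTensor H (conjMap R (h ⊗ₜ u)), ?_⟩
    rw [passPair_parPass_ι, passPair_twistedComul]
    induction conjMap R (h ⊗ₜ u) with
    | zero => simp
    | add a b ha hb => simp only [map_add, ha, hb]
    | tmul a b => simp
  | halg c =>
    refine ⟨c • (1 ⊗ₜ h), ?_⟩
    rw [Algebra.algebraMap_eq_smul_one, tmul_smul, map_smul, passPair_one, map_smul,
      LinearMap.lTensor_tmul]
  | hmul x y hx hy =>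
    obtain ⟨z, hz⟩ := hx h
    rw [passPair_mul _ (parPass_mul R), hz]
    clear hz
    induction z with
    | zero => exact ⟨0, by simp⟩
    | add a b ha hb =>
      obtain ⟨a', ha⟩ := ha
      obtain ⟨b', hb⟩ := hb
      exact ⟨a' + b', by simp only [map_add, ha, hb]⟩
    | tmul p q =>
      obtain ⟨z, hz⟩ := hy q
      refine ⟨(p ⊗ₜ 1) * z, ?_⟩
      rw [LinearMap.lTensor_tmul, opr_tmul, hz]
      clear hz
      induction z with
      | zero => simp
      | add a b ha hb => simp only [mul_add, map_add, ha, hb]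
      | tmul a b => simp
  | hadd x y hx hy =>
    obtain ⟨a, ha⟩ := hx h
    obtain ⟨b, hb⟩ := hy h
    exact ⟨a + b, by simp only [tmul_add, map_add, ha, hb]⟩

end LetterPassing

end PartialHopf

namespace PartialHopf

/-! ### Second stage: words in H_par cross words in U_par. -/

section WordPassing

open Coalgebra HopfAlgebra

variable {k : Type*} [Field k]
  {U : Type*} [Ring U] [HopfAlgebra k U] {H : Type*} [Ring H] [HopfAlgebra k H]
  (R : H ⊗[k] U →ₗ[k] U ⊗[k] H) [IsNormal R] [IsMultiplicative R] [IsCoalgMap R]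

theorem passPair_mul_left (g : H) (z : H ⊗[k] H) (t : Par k U) :
    passPair (parPass R) (((g ⊗ₜ 1) * z) ⊗ₜ t) =
      opl ((tinl k H).toLinearMap.lTensor (Par k U) ∘ₗ parPass R) g
        (passPair (parPass R) (z ⊗ₜ t)) := by
  induction z with
  | zero => simp
  | add a b ha hb => simp only [mul_add, add_tmul, map_add, ha, hb]
  | tmul a b =>
  rw [Algebra.TensorProduct.tmul_mul_tmul, one_mul, passPair_tmul, passPair_tmul]
  induction parPass R (b ⊗ₜ t) with
  | zero => simp
  | add a b ha hb => simp only [tmul_add, map_add, ha, hb]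
  | tmul p q =>
  rw [passLeftTensor_tmul, passLeftTensor_tmul, parPass_mul_tmul]
  induction parPass R (a ⊗ₜ p) with
  | zero => simp
  | add a b ha hb => simp only [add_tmul, map_add, ha, hb]
  | tmul c d =>
  rw [TensorProduct.assoc_tmul, opl_tmul, opl_tmul, LinearMap.comp_apply]
  induction parPass R (g ⊗ₜ c) with
  | zero => simp
  | add a b ha hb => simp only [add_mul, add_tmul, map_add, ha, hb]
  | tmul c d => simp

theorem passPair_mul_right (g : H) (z : H ⊗[k] H) (t : Par k U) :
    passPair (parPass R) ((z * (1 ⊗ₜ g)) ⊗ₜ t) =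
      opl (passPair (parPass R)) z
        ((tinr k H).toLinearMap.lTensor (Par k U) (parPass R (g ⊗ₜ t))) := by
  induction z with
  | zero => simp
  | add a b ha hb => simp only [add_mul, add_tmul, map_add, ha, hb, LinearMap.add_apply]
  | tmul a b =>
  rw [Algebra.TensorProduct.tmul_mul_tmul, mul_one, passPair_tmul, parPass_mul_tmul]
  induction parPass R (g ⊗ₜ t) with
  | zero => simp
  | add a b ha hb => simp only [tmul_add, map_add, ha, hb]
  | tmul p q =>
  rw [LinearMap.lTensor_tmul, opl_tmul, opl_tmul, passPair_tmul]
  induction parPass R (b ⊗ₜ p) with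
  | zero => simp
  | add a b ha hb => simp only [add_mul, tmul_add, map_add, ha, hb]
  | tmul c d =>
  rw [Algebra.TensorProduct.tmul_mul_tmul, mul_one, passLeftTensor_tmul, passLeftTensor_tmul]
  induction parPass R (a ⊗ₜ c) with
  | zero => simp
  | add a b ha hb => simp only [add_mul, add_tmul, map_add, ha, hb]
  | tmul c d => simp

/-- The map `h ↦ (t ⊗ y ↦ t^R ⊗ [h^R] y)`. -/
noncomputable def wordPass : H →ₗ[k] Module.End k (Par k U ⊗[k] Par k H) :=
  opl ((Par.ι k H).lTensor (Par k U) ∘ₗ parPass R)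

theorem mulPair_wordPass (z : H ⊗[k] H) (t : Par k U) (y : Par k H) :
    mulPair (wordPass R) z (t ⊗ₜ y) =
      (mulPair (Par.ι k H)).lTensor (Par k U) (passPair (parPass R) (z ⊗ₜ t)) * (1 ⊗ₜ y) := by
  induction z with
  | zero => simp
  | add a b ha hb => simp only [add_mul, add_tmul, map_add, LinearMap.add_apply, ha, hb]
  | tmul a b =>
  rw [mulPair_tmul, Module.End.mul_apply, wordPass, opl_tmul, opl_mul, passPair_tmul,
    LinearMap.comp_apply]
  congr 1
  induction parPass R (b ⊗ₜ t) with
  | zero => simp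
  | add a b ha hb => simp only [tmul_add, map_add, ha, hb]
  | tmul p q =>
  rw [passLeftTensor_tmul, LinearMap.lTensor_tmul, opl_tmul, LinearMap.comp_apply]
  induction parPass R (a ⊗ₜ p) with
  | zero => simp
  | add a b ha hb => simp only [add_mul, add_tmul, map_add, ha, hb]
  | tmul c d => simp [mulPair_tmul]

/-- By `exists_passPair_twistedComul`, once h₁ ⊗ S(h₂) has crossed any word it is still a
combination of such elements, so the relations of H_par give both axioms. -/
theorem isPartialRep_wordPass : IsPartialRep (wordPass R) := by
  have hι := isPartialRep_iff.mp (Par.isPartialRep_ι k H)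
  refine isPartialRep_iff.mpr ⟨?_, fun g a => ?_, fun a g => ?_⟩
  · refine TensorProduct.ext' fun t y => ?_
    rw [wordPass, opl_tmul, LinearMap.comp_apply, parPass_one_tmul]
    simp [hι.1]
  · refine TensorProduct.ext' fun t y => ?_
    rw [Module.End.mul_apply, mulPair_wordPass, mulPair_wordPass, wordPass, opl_mul,
      passPair_mul_left]
    obtain ⟨E, hE⟩ := exists_passPair_twistedComul R a t
    rw [hE]
    congr 1
    clear hE
    induction E with
    | zero => simp
    | add a b ha hb => simp only [map_add, ha, hb]
    | tmul p x =>
    rw [LinearMap.lTensor_tmul, LinearMap.lTensor_tmul, opl_tmul, opl_tmul, LinearMap.comp_apply,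
      LinearMap.comp_apply]
    induction parPass R (g ⊗ₜ p) with
    | zero => simp
    | add a b ha hb => simp only [add_mul, map_add, ha, hb]
    | tmul c d =>
      have := hι.2.1 d x
      simp [this]
  · refine TensorProduct.ext' fun t y => ?_
    rw [Module.End.mul_apply, mulPair_wordPass, wordPass, opl_tmul, ← wordPass,
      passPair_mul_right, LinearMap.comp_apply]
    induction parPass R (g ⊗ₜ t) with
    | zero => simp
    | add a b ha hb => simp only [add_mul, map_add, ha, hb]
    | tmul p q =>
    rw [LinearMap.lTensor_tmul, LinearMap.lTensor_tmul, Algebra.TensorProduct.tmul_mul_tmul,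
      mul_one, mulPair_wordPass, opl_tmul]
    obtain ⟨E, hE⟩ := exists_passPair_twistedComul R a p
    rw [hE]
    clear hE
    induction E with
    | zero => simp
    | add a b ha hb => simp only [add_mul, map_add, ha, hb]
    | tmul p x =>
      have := hι.2.2 x q
      simp [← this, mul_assoc]

/-- The map `H_par ⊗ U_par → U_par ⊗ H_par` induced by `R`. -/
noncomputable def parTwist : Par k H ⊗[k] Par k U →ₗ[k] Par k U ⊗[k] Par k H :=
  TensorProduct.lift ((Par.lift (wordPass R) (isPartialRep_wordPass R)).toLinearMap.compl₂
    ((TensorProduct.mk k (Par k U) (Par k H)).flip 1))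

theorem parTwist_tmul (y : Par k H) (t : Par k U) : parTwist R (y ⊗ₜ t) =
    Par.lift (wordPass R) (isPartialRep_wordPass R) y (t ⊗ₜ 1) := rfl

/-- The operators commute with right multiplication by H_par, so their values on t ⊗ 1, namely
`parTwist`, determine them. -/
theorem lift_wordPass (y : Par k H) :
    Par.lift (wordPass R) (isPartialRep_wordPass R) y = opl (parTwist R) y := by
  have h : ∀ (q : Par k H) (Z : Par k U ⊗[k] Par k H),
      Par.lift (wordPass R) (isPartialRep_wordPass R) y (Z * (1 ⊗ₜ q)) =
      Par.lift (wordPass R) (isPartialRep_wordPass R) y Z * (1 ⊗ₜ q) := by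
    induction y using Par.induction with
    | hι a =>
      intro q Z
      rw [Par.lift_ι, wordPass, opl_mul]
    | halg c =>
      intro q Z
      simp [Algebra.algebraMap_eq_smul_one]
    | hmul x y hx hy =>
      intro q Z
      rw [map_mul (Par.lift _ _), Module.End.mul_apply, Module.End.mul_apply, hy, hx]
    | hadd x y hx hy =>
      intro q Z
      rw [map_add, LinearMap.add_apply, LinearMap.add_apply, hx, hy, add_mul]
  refine TensorProduct.ext' fun t q => ?_
  rw [opl_tmul, parTwist_tmul, ← h, Algebra.TensorProduct.tmul_mul_tmul, one_mul, mul_one]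

theorem parTwist_mul_tmul (x y : Par k H) (t : Par k U) :
    parTwist R ((x * y) ⊗ₜ t) = opl (parTwist R) x (parTwist R (y ⊗ₜ t)) := by
  rw [parTwist_tmul, map_mul, Module.End.mul_apply, ← parTwist_tmul, lift_wordPass]

theorem parTwist_ι_tmul (h : H) (t : Par k U) :
    parTwist R (Par.ι k H h ⊗ₜ t) = (Par.ι k H).lTensor (Par k U) (parPass R (h ⊗ₜ t)) := by
  rw [parTwist_tmul, Par.lift_ι, wordPass, opl_tmul, ← Algebra.TensorProduct.one_def, mul_one]
  rfl

theorem parTwist_ι_tmul_ι (h : H) (u : U) :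
    parTwist R (Par.ι k H h ⊗ₜ Par.ι k U u) =
      TensorProduct.map (Par.ι k U) (Par.ι k H) (R (h ⊗ₜ u)) := by
  rw [parTwist_ι_tmul, parPass_ι, ← LinearMap.comp_apply, LinearMap.lTensor_comp_rTensor]

theorem parTwist_one_tmul (t : Par k U) : parTwist R (1 ⊗ₜ t) = t ⊗ₜ 1 := by
  rw [parTwist_tmul, map_one]
  rfl

theorem parTwist_algebraMap (c : k) (t : Par k U) :
    parTwist R (algebraMap k _ c ⊗ₜ t) = c • (t ⊗ₜ 1) := by
  rw [Algebra.algebraMap_eq_smul_one, ← smul_tmul', map_smul, parTwist_one_tmul]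

theorem parTwist_tmul_one (y : Par k H) : parTwist R (y ⊗ₜ 1) = 1 ⊗ₜ y := by
  induction y using Par.induction with
  | hι a => rw [parTwist_ι_tmul, parPass_one, LinearMap.lTensor_tmul]
  | halg c => rw [parTwist_algebraMap, Algebra.algebraMap_eq_smul_one, tmul_smul]
  | hmul x y hx hy =>
    rw [parTwist_mul_tmul, hy, opl_tmul, hx, Algebra.TensorProduct.tmul_mul_tmul, one_mul]
  | hadd x y hx hy => rw [add_tmul, map_add, hx, hy, tmul_add]

/-- Induction on the word y: letters are covered by `parPass_mul`, and products follow since left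
and right crossings commute. -/
theorem parTwist_tmul_mul (y : Par k H) (t t' : Par k U) :
    parTwist R (y ⊗ₜ (t * t')) = opr (parTwist R) t' (parTwist R (y ⊗ₜ t)) := by
  induction y using Par.induction generalizing t t' with
  | hι h =>
    rw [parTwist_ι_tmul, parTwist_ι_tmul, parPass_mul]
    induction parPass R (h ⊗ₜ t) with
    | zero => simp
    | add a b ha hb => simp only [map_add, ha, hb]
    | tmul p q =>
    rw [LinearMap.lTensor_tmul, opr_tmul, opr_tmul, parTwist_ι_tmul]
    induction parPass R (q ⊗ₜ t') with
    | zero => simp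
    | add a b ha hb => simp only [map_add, mul_add, ha, hb]
    | tmul p q => simp
  | halg c =>
    rw [parTwist_algebraMap, parTwist_algebraMap, map_smul, opr_tmul, parTwist_one_tmul,
      Algebra.TensorProduct.tmul_mul_tmul, one_mul]
  | hmul x y hx hy =>
    rw [parTwist_mul_tmul, parTwist_mul_tmul, hy,
      opl_opr_comm _ hx fun s q => parTwist_mul_tmul R s q t']
  | hadd x y hx hy => simp only [add_tmul, map_add, hx, hy]

instance isNormal_parTwist : IsNormal (parTwist R) where
  left := parTwist_tmul_one R
  right := parTwist_one_tmul R

instance isMultiplicative_parTwist : IsMultiplicative (parTwist R) :=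
  .of_opl_opr _ (parTwist_mul_tmul R) (parTwist_tmul_mul R)

/-- The statement for the initial tensor alone does not pass through products, so the induction
compares the operators of the word on arbitrary elements; `isInducedTwist_parTwist` proceeds
likewise on the H side. -/
theorem rTensor_proj_passWord (h : H) (t : TensorAlgebra k U) :
    (Par.proj k U).toLinearMap.rTensor H (passWord R (h ⊗ₜ t)) =
      parPass R (h ⊗ₜ Par.proj k U t) := by
  let φ : TensorAlgebra k U →ₐ[k] (Module.End k (TensorAlgebra k U ⊗[k] H))ᵐᵒᵖ :=
    TensorAlgebra.lift k ((MulOpposite.opLinearEquiv k).toLinearMap ∘ₗ passRight R)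
  have key : ∀ Z, (Par.proj k U).toLinearMap.rTensor H ((φ t).unop Z) =
      opr (parPass R) (Par.proj k U t) ((Par.proj k U).toLinearMap.rTensor H Z) := by
    induction t using TensorAlgebra.induction with
    | algebraMap c =>
      intro Z
      rw [AlgHom.commutes, AlgHom.commutes, ← unop_lift_letterPass, AlgHom.commutes]
      simp [Algebra.algebraMap_eq_smul_one]
    | ι u =>
      intro Z
      have hφ : (φ (TensorAlgebra.ι k u)).unop = passRight R u := by simp [φ]
      rw [hφ, Par.proj_ι]
      induction Z with
      | zero => simp
      | add a b ha hb => simp only [map_add, ha, hb]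
      | tmul s h =>
      rw [passRight_apply, LinearMap.rTensor_tmul, opr_tmul, parPass_ι]
      induction R (h ⊗ₜ u) with
      | zero => simp
      | add a b ha hb => simp only [map_add, mul_add, ha, hb]
      | tmul p q => simp [Par.proj_ι]
    | mul x y hx hy =>
      intro Z
      rw [map_mul φ, MulOpposite.unop_mul, Module.End.mul_apply, hy, hx, map_mul, opr_parPass_mul,
        Module.End.mul_apply]
    | add x y hx hy =>
      intro Z
      rw [map_add φ, MulOpposite.unop_add, LinearMap.add_apply, map_add, hx, hy, map_add, map_add,
        LinearMap.add_apply]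
  have h1 : passWord R (h ⊗ₜ t) = (φ t).unop (1 ⊗ₜ h) := by simp [passWord, φ]
  rw [h1, key, LinearMap.rTensor_tmul, opr_tmul, AlgHom.toLinearMap_apply, map_one,
    ← Algebra.TensorProduct.one_def, one_mul]

theorem isInducedTwist_parTwist : IsInducedTwist R (parTwist R) := by
  refine TensorProduct.ext' fun x t => ?_
  let φ : TensorAlgebra k H →ₐ[k] Module.End k (TensorAlgebra k U ⊗[k] TensorAlgebra k H) :=
    TensorAlgebra.lift k (passLeft R)
  have key : ∀ Z, TensorProduct.map (Par.proj k U).toLinearMap (Par.proj k H).toLinearMap (φ x Z) =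
      opl (parTwist R) (Par.proj k H x)
        (TensorProduct.map (Par.proj k U).toLinearMap (Par.proj k H).toLinearMap Z) := by
    induction x using TensorAlgebra.induction with
    | algebraMap c =>
      intro Z
      rw [AlgHom.commutes, AlgHom.commutes, ← lift_wordPass, AlgHom.commutes]
      simp [Algebra.algebraMap_eq_smul_one]
    | ι h =>
      intro Z
      have hφ : φ (TensorAlgebra.ι k h) = passLeft R h := by simp [φ]
      rw [hφ, Par.proj_ι]
      induction Z with
      | zero => simp
      | add a b ha hb => simp only [map_add, ha, hb]
      | tmul s y =>
      rw [passLeft_apply, map_tmul, opl_tmul, parTwist_ι_tmul, AlgHom.toLinearMap_apply,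
        ← rTensor_proj_passWord]
      induction passWord R (h ⊗ₜ s) with
      | zero => simp
      | add a b ha hb => simp only [map_add, add_mul, ha, hb]
      | tmul p q => simp [Par.proj_ι]
    | mul x y hx hy =>
      intro Z
      rw [map_mul φ, Module.End.mul_apply, hx, hy, map_mul, ← lift_wordPass, ← lift_wordPass,
        ← lift_wordPass, map_mul (Par.lift _ _), Module.End.mul_apply]
    | add x y hx hy =>
      intro Z
      rw [map_add φ, LinearMap.add_apply, map_add, hx, hy, map_add, map_add, LinearMap.add_apply]
  have h1 : wordTwist R (x ⊗ₜ t) = φ x (t ⊗ₜ 1) := by simp [wordTwist, φ]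
  rw [LinearMap.comp_apply, map_tmul, parWordTwist, LinearMap.comp_apply, h1, key, map_tmul,
    opl_tmul, AlgHom.toLinearMap_apply, AlgHom.toLinearMap_apply, AlgHom.toLinearMap_apply,
    map_one, ← Algebra.TensorProduct.one_def, mul_one]

end WordPassing

end PartialHopf

namespace PartialHopf

/-! ### A compatible pair defines a partial representation of the smash product. -/

section PairMap

open Coalgebra HopfAlgebra

variable {k : Type*} [Field k]
  {U : Type*} [Ring U] [HopfAlgebra k U] {H : Type*} [Ring H] [HopfAlgebra k H]
  (R : H ⊗[k] U →ₗ[k] U ⊗[k] H) {B : Type*} [Ring B] [Algebra k B]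
  (α : U →ₗ[k] B) (η : H →ₗ[k] B)

/-- The map `h ↦ η(h₁) η(S h₂)`. -/
noncomputable def mulTwisted : H →ₗ[k] B := mulPair η ∘ₗ twistedComul k H

theorem mulTwisted_apply (h : H) : mulTwisted η h = mulPair η (twistedComul k H h) := rfl

/-- The linear map `u # h ↦ α(u) η(h)`. -/
noncomputable def pairMap : Smash R →ₗ[k] B :=
  LinearMap.mul' k B ∘ₗ TensorProduct.map α η ∘ₗ (Smash.of R).symm.toLinearMap

theorem pairMap_of (x : U ⊗[k] H) :
    pairMap R α η (Smash.of R x) = LinearMap.mul' k B (TensorProduct.map α η x) := by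
  simp [pairMap]

theorem pairMap_mk (u : U) (h : H) : pairMap R α η (Smash.mk R u h) = α u * η h := by
  rw [Smash.mk, pairMap_of]
  simp

theorem pairMap_mul [IsNormal R] [IsMultiplicative R] (v : U) (g : H) (a : U) (c : H) :
    pairMap R α η (Smash.of R (v ⊗ₜ g) * Smash.of R (a ⊗ₜ c)) = LinearMap.mul' k B
      (TensorProduct.map (α ∘ₗ LinearMap.mulLeft k v) (η ∘ₗ LinearMap.mulRight k c)
        (R (g ⊗ₜ a))) := by
  change pairMap R α η (Smash.mk R v g * Smash.mk R a c) = _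
  rw [Smash.mk_mul_mk, pairMap_of, ← LinearMap.comp_apply (TensorProduct.map α η),
    ← TensorProduct.map_comp]

variable [IsNormal R] [IsMultiplicative R] [IsCoalgMap R]

variable {α η} (hα : IsPartialRep α) (hη : IsPartialRep η)
  (hc : ∀ u h, η h * α u = LinearMap.mul' k B (TensorProduct.map α η (R (h ⊗ₜ[k] u))))

include hη in
theorem mulPair_mul_twistedComul_eq (q h : H) :
    mulPair η ((q ⊗ₜ 1) * twistedComul k H h) = η q * mulTwisted η h :=
  ((isPartialRep_iff.mp hη).2.1 q h).symm

include hη in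
theorem mulPair_twistedComul_mul_eq (h q : H) :
    mulPair η (twistedComul k H h * (1 ⊗ₜ q)) = mulTwisted η h * η q :=
  ((isPartialRep_iff.mp hη).2.2 h q).symm

include hc in
-- Compatibility, used twice, carries α(u) past both factors of e_h = η(h₁)η(S h₂); by
-- `passPair_twistedComul` the crossed pairs again assemble into such elements.
theorem mulTwisted_mul (h : H) (u : U) : mulTwisted η h * α u =
    LinearMap.mul' k B (TensorProduct.map α (mulTwisted η) (conjMap R (h ⊗ₜ u))) := by
  have h1 : ∀ z : H ⊗[k] H, mulPair η z * α u =
      LinearMap.mul' k B (TensorProduct.map α (mulPair η) (passPair R (z ⊗ₜ u))) := by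
    intro z
    induction z with
    | zero => simp
    | add a b ha hb => simp only [add_tmul, map_add, add_mul, ha, hb]
    | tmul g h =>
    rw [mulPair_tmul, mul_assoc, hc, passPair_tmul]
    induction R (h ⊗ₜ u) with
    | zero => simp
    | add a b ha hb => simp only [tmul_add, map_add, mul_add, ha, hb]
    | tmul p q =>
    rw [map_tmul, LinearMap.mul'_apply, ← mul_assoc, hc, passLeftTensor_tmul]
    induction R (g ⊗ₜ p) with
    | zero => simp
    | add a b ha hb => simp only [add_tmul, map_add, add_mul, ha, hb]
    | tmul c d => simp [mulPair_tmul, mul_assoc]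
  rw [mulTwisted_apply, h1, passPair_twistedComul]
  induction conjMap R (h ⊗ₜ u) with
  | zero => simp
  | add a b ha hb => simp only [map_add, ha, hb]
  | tmul c d => simp [mulTwisted_apply]

include hη hc in
-- Moving u past both letters puts them in the form x₁ ⊗ S(x₂), where the right axiom for η splits
-- η(S(x₂)g) off as η(g); then u is moved back.
theorem sum_mul_map_eq (h g : H) (u : U) (F : H ⊗[k] H →ₗ[k] B)
    (hF : ∀ c d, F (c ⊗ₜ d) = η c * LinearMap.mul' k B
      (TensorProduct.map α (η ∘ₗ LinearMap.mulRight k g) (R (d ⊗ₜ u)))) :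
    F (twistedComul k H h) = mulTwisted η h * α u * η g := by
  have h1 : ∀ z : H ⊗[k] H, F z = LinearMap.mul' k B (TensorProduct.map α
      (mulPair η ∘ₗ LinearMap.mulRight k (1 ⊗ₜ g)) (passPair R (z ⊗ₜ u))) := by
    intro z
    induction z with
    | zero => simp
    | add a b ha hb => simp only [add_tmul, map_add, ha, hb]
    | tmul c d =>
    rw [hF, passPair_tmul]
    induction R (d ⊗ₜ u) with
    | zero => simp
    | add a b ha hb => simp only [tmul_add, map_add, mul_add, ha, hb]
    | tmul p q =>
    rw [map_tmul, LinearMap.mul'_apply, ← mul_assoc, hc, passLeftTensor_tmul]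
    induction R (c ⊗ₜ p) with
    | zero => simp
    | add a b ha hb => simp only [add_tmul, map_add, add_mul, ha, hb]
    | tmul c d => simp [mulPair_tmul, mul_assoc]
  rw [h1, passPair_twistedComul, mulTwisted_mul R hc]
  induction conjMap R (h ⊗ₜ u) with
  | zero => simp
  | add a b ha hb => simp only [map_add, add_mul, ha, hb]
  | tmul p x => simp [mulPair_twistedComul_mul_eq hη, mul_assoc]

include hc in
theorem pairMap_antipode (b : U) (d : H) :
    pairMap R α η (antipode k (Smash.of R (b ⊗ₜ d))) = η (antipode k d) * α (antipode k b) := by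
  change pairMap R α η (smashAntipode R (Smash.of R (b ⊗ₜ d))) = _
  rw [smashAntipode_of, Smash.inclRight_mul_inclLeft, pairMap_of, hc]

/-- S(b # d)(v # g) = (1 # S d)(S(b)v # 1)(1 # g), so a single application of R suffices. -/
theorem pairMap_antipode_mul (b v : U) (d g : H) :
    pairMap R α η (antipode k (Smash.of R (b ⊗ₜ d)) * Smash.of R (v ⊗ₜ g)) =
      LinearMap.mul' k B (TensorProduct.map α (η ∘ₗ LinearMap.mulRight k g)
        (R (antipode k d ⊗ₜ (antipode k b * v)))) := by
  change pairMap R α η (smashAntipode R (Smash.of R (b ⊗ₜ d)) * _) = _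
  rw [smashAntipode_of, ← Smash.inclLeft_mul_inclRight, mul_assoc,
    ← mul_assoc (Smash.inclLeft R (antipode k b)), ← map_mul, ← mul_assoc,
    Smash.inclRight_mul_inclLeft]
  generalize R (antipode k d ⊗ₜ (antipode k b * v)) = X
  induction X with
  | zero => simp
  | add a b ha hb => simp only [map_add, add_mul, ha, hb]
  | tmul p q =>
    rw [← Smash.inclLeft_mul_inclRight, mul_assoc, ← map_mul, Smash.inclLeft_mul_inclRight,
      pairMap_of]
    simp

/-- The map `a ⊗ b ↦ ψ(a^R) α(b^r) η(g^{Rr})`. -/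
noncomputable def twoPassMap (α ψ : U →ₗ[k] B) (η : H →ₗ[k] B) (g : H) : U ⊗[k] U →ₗ[k] B :=
  LinearMap.mul' k B ∘ₗ TensorProduct.map (LinearMap.mul' k B ∘ₗ TensorProduct.map ψ α) η ∘ₗ
    passTwo R ∘ₗ TensorProduct.mk k H (U ⊗[k] U) g

include hc in
theorem mul_eq_twoPassMap (ψ : U →ₗ[k] B) (g : H) (a b : U) :
    LinearMap.mul' k B (TensorProduct.map ψ η (R (g ⊗ₜ a))) * α b =
      twoPassMap R α ψ η g (a ⊗ₜ b) := by
  simp only [twoPassMap, LinearMap.comp_apply, mk_apply]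
  rw [passTwo_tmul]
  induction R (g ⊗ₜ a) with
  | zero => simp
  | add a b ha hb => simp only [add_tmul, map_add, add_mul, ha, hb]
  | tmul p q =>
  rw [map_tmul, LinearMap.mul'_apply, mul_assoc, hc, TensorProduct.assoc_tmul,
    LinearMap.lTensor_tmul]
  induction R (q ⊗ₜ b) with
  | zero => simp
  | add a b ha hb => simp only [tmul_add, map_add, mul_add, ha, hb]
  | tmul p q => simp [mul_assoc]

include hα in
-- After crossing g, the pair u₁ ⊗ S(u₂) is x₁ ⊗ S(x₂) with x = g₁ ▷ u, so the left axiom for α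
-- merges α(v) into the first factor.
theorem mul_twoPassMap_twistedComul (v : U) (g : H) (u : U) :
    α v * twoPassMap R α α η g (twistedComul k U u) =
      twoPassMap R α (α ∘ₗ LinearMap.mulLeft k v) η g (twistedComul k U u) := by
  simp only [twoPassMap, LinearMap.comp_apply, mk_apply]
  rw [passTwo_twistedComul]
  generalize (actLeft R ∘ₗ (TensorProduct.mk k H U).flip u).rTensor H (comul (R := k) g) = E
  induction E with
  | zero => simp
  | add a b ha hb => simp only [map_add, mul_add, ha, hb]
  | tmul x y =>
    have h1 : ∀ z : U ⊗[k] U, LinearMap.mul' k B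
        (TensorProduct.map (α ∘ₗ LinearMap.mulLeft k v) α z) = mulPair α ((v ⊗ₜ 1) * z) := by
      intro z
      induction z with
      | zero => simp
      | add a b ha hb => simp only [map_add, mul_add, ha, hb]
      | tmul a b => simp [mulPair_tmul]
    have h2 := (isPartialRep_iff.mp hα).2.1 v x
    simp only [LinearMap.rTensor_tmul, map_tmul, LinearMap.comp_apply, LinearMap.mul'_apply, h1]
    rw [← h2, mul_assoc]
    rfl

include hc in
-- Moves e_h to the far right past α(S u₂), and then the crossed η(g) past α(S u₂), so that both
-- U-factors become adjacent. The map ψ is free because it is used for α and for α(v ·).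
theorem sum_mul_mulTwisted_mul (ψ : U →ₗ[k] B) (g h : H) (u : U) (F : U ⊗[k] U →ₗ[k] B)
    (hF : ∀ a b, F (a ⊗ₜ b) = LinearMap.mul' k B (TensorProduct.map ψ η (R (g ⊗ₜ a))) *
      (mulTwisted η h * α b)) :
    F (twistedComul k U u) = LinearMap.mul' k B (TensorProduct.map
      (twoPassMap R α ψ η g ∘ₗ twistedComul k U) (mulTwisted η ∘ₗ actPair R ∘ₗ
        TensorProduct.mk k (H ⊗[k] H) U (twistedComul k H h) ∘ₗ antipode k)
      (comul (R := k) u)) := by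
  have h1 : ∀ w : U ⊗[k] U, F w = LinearMap.mul' k B (TensorProduct.map
      (twoPassMap R α ψ η g) (mulTwisted η) ((TensorProduct.assoc k U U H).symm
        ((conjMap R ∘ₗ TensorProduct.mk k H U h).lTensor U w))) := by
    intro w
    induction w with
    | zero => simp
    | add a b ha hb => simp only [map_add, ha, hb]
    | tmul a b =>
    rw [hF, mulTwisted_mul R hc, LinearMap.lTensor_tmul, LinearMap.comp_apply, mk_apply]
    induction conjMap R (h ⊗ₜ b) with
    | zero => simp
    | add a b ha hb => simp only [tmul_add, map_add, mul_add, ha, hb]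
    | tmul p c => simp [← mul_eq_twoPassMap R hc, mul_assoc]
  rw [h1, lTensor_conjMap_twistedComul, LinearEquiv.symm_apply_apply,
    ← LinearMap.comp_apply (TensorProduct.map _ _), ← TensorProduct.map_comp]

include hα hc in
-- Once e_h has been moved past α(S u₂) it becomes e_c, and crossing v turns both sides into sums
-- over α(u₁), α(S u₂) and a crossed v' followed by some e_{c'}; `conjMap_mul` gives this for
-- S(u₂)v. The right axiom for α then identifies α(S u₂)α(v') with α(S(u₂)v') under α(u₁).
theorem sum_mulTwisted_mul_mul (h : H) (u v : U) (F G : U ⊗[k] U →ₗ[k] B)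
    (hF : ∀ a b, F (a ⊗ₜ b) = α a * (mulTwisted η h * α b) * α v)
    (hG : ∀ a b, G (a ⊗ₜ b) = α a * (mulTwisted η h * α (b * v))) :
    F (twistedComul k U u) = G (twistedComul k U u) := by
  let L : U ⊗[k] (U ⊗[k] H) →ₗ[k] B := LinearMap.mulRight k (α v) ∘ₗ LinearMap.mul' k B ∘ₗ
    TensorProduct.map α (LinearMap.mul' k B ∘ₗ TensorProduct.map α (mulTwisted η))
  let M : U ⊗[k] (U ⊗[k] H) →ₗ[k] B := LinearMap.mul' k B ∘ₗ
    TensorProduct.map α (LinearMap.mul' k B ∘ₗ TensorProduct.map α (mulTwisted η) ∘ₗ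
      opr (conjMap R) v)
  have h1 : ∀ w : U ⊗[k] U, F w = L ((conjMap R ∘ₗ TensorProduct.mk k H U h).lTensor U w) := by
    intro w
    induction w with
    | zero => simp
    | add a b ha hb => simp only [map_add, ha, hb]
    | tmul a b => simp [hF, L, mulTwisted_mul R hc]
  have h2 : ∀ w : U ⊗[k] U, G w = M ((conjMap R ∘ₗ TensorProduct.mk k H U h).lTensor U w) := by
    intro w
    induction w with
    | zero => simp
    | add a b ha hb => simp only [map_add, ha, hb]
    | tmul a b => simp [hG, M, mulTwisted_mul R hc, conjMap_mul]
  rw [h1, h2, lTensor_conjMap_twistedComul]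
  induction comul (R := k) u with
  | zero => simp
  | add a b ha hb => simp only [map_add, ha, hb]
  | tmul x y =>
  rw [map_tmul]
  generalize (actPair R ∘ₗ TensorProduct.mk k (H ⊗[k] H) U (twistedComul k H h) ∘ₗ antipode k) y = c
  have h3 : ∀ w : U ⊗[k] U, L (TensorProduct.assoc k U U H (w ⊗ₜ c)) =
      mulPair α w * (mulTwisted η c * α v) := by
    intro w
    induction w with
    | zero => simp
    | add a b ha hb => simp only [add_tmul, map_add, add_mul, ha, hb]
    | tmul a b => simp [L, mulPair_tmul, mul_assoc]
  have h4 : ∀ w : U ⊗[k] U, M (TensorProduct.assoc k U U H (w ⊗ₜ c)) =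
      LinearMap.mul' k B (TensorProduct.map (mulPair α ∘ₗ LinearMap.mulLeft k w ∘ₗ
        (tinr k U).toLinearMap) (mulTwisted η) (conjMap R (c ⊗ₜ v))) := by
    intro w
    induction w with
    | zero =>
      rw [zero_tmul, map_zero, map_zero, LinearMap.mulLeft_zero_eq_zero, LinearMap.zero_comp,
        LinearMap.comp_zero, TensorProduct.map_zero_left, LinearMap.zero_apply, map_zero]
    | add a b ha hb =>
      have : LinearMap.mulLeft k (a + b) = LinearMap.mulLeft k a + LinearMap.mulLeft k b := by
        ext; simp [add_mul]
      rw [add_tmul, map_add, map_add, ha, hb, this, LinearMap.add_comp, LinearMap.comp_add,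
        TensorProduct.map_add_left, LinearMap.add_apply, map_add]
    | tmul a b =>
      simp only [M, TensorProduct.assoc_tmul, LinearMap.comp_apply, map_tmul, LinearMap.mul'_apply,
        opr_tmul]
      induction conjMap R (c ⊗ₜ v) with
      | zero => simp
      | add a b ha hb => simp only [map_add, mul_add, ha, hb]
      | tmul p q => simp [mulPair_tmul, mul_assoc]
  rw [h3, h4, mulTwisted_mul R hc]
  induction conjMap R (c ⊗ₜ v) with
  | zero => simp
  | add a b ha hb => simp only [map_add, mul_add, ha, hb]
  | tmul p q =>
    have h5 := (isPartialRep_iff.mp hα).2.2 x p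
    simp [← h5, mul_assoc]

/-- Evaluates the sum over Δ(u # h) as an iterated sum: `G` sums over Δ(h) with the legs of u fixed,
`F` over Δ(u). -/
theorem mul'_map_comul_of (u : U) (h : H) (f g : Smash R →ₗ[k] B) (F : U ⊗[k] U →ₗ[k] B)
    (G : U → U → H ⊗[k] H →ₗ[k] B)
    (hG : ∀ a b c d, G a b (c ⊗ₜ d) = f (Smash.of R (a ⊗ₜ c)) * g (Smash.of R (b ⊗ₜ d)))
    (hF : ∀ a b, F (a ⊗ₜ b) = G a b (comul (R := k) h)) :
    LinearMap.mul' k B (TensorProduct.map f g (comul (R := k) (Smash.of R (u ⊗ₜ h)))) =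
      F (comul (R := k) u) := by
  rw [Smash.comul_of, TensorProduct.comul_tmul]
  induction comul (R := k) u with
  | zero => simp
  | add a b ha hb => simp only [add_tmul, map_add, ha, hb]
  | tmul a b =>
  rw [hF]
  induction comul (R := k) h with
  | zero => simp
  | add a b ha hb => simp only [tmul_add, map_add, ha, hb]
  | tmul c d => simp [hG]

include hη hc in
-- The general f covers both π itself (with g = 1) and y ↦ π((v # g)y). The inner sum over Δ(h) is
-- η(g^R h₁)η(S h₂) = η(g^R) e_h, by the left axiom for η.
theorem sum_pairMap_antipode (ψ : U →ₗ[k] B) (g : H) (f : Smash R →ₗ[k] B)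
    (hf : ∀ a c, f (Smash.of R (a ⊗ₜ c)) = LinearMap.mul' k B
      (TensorProduct.map ψ (η ∘ₗ LinearMap.mulRight k c) (R (g ⊗ₜ a)))) (u : U) (h : H) :
    LinearMap.mul' k B (TensorProduct.map f (pairMap R α η ∘ₗ antipode k)
        (comul (R := k) (Smash.of R (u ⊗ₜ h)))) =
      LinearMap.mul' k B (TensorProduct.map
        (LinearMap.mul' k B ∘ₗ TensorProduct.map ψ η ∘ₗ R ∘ₗ TensorProduct.mk k H U g)
        (LinearMap.mulLeft k (mulTwisted η h) ∘ₗ α) (twistedComul k U u)) := by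
  refine (mul'_map_comul_of R u h f _ (LinearMap.mul' k B ∘ₗ TensorProduct.map
        (LinearMap.mul' k B ∘ₗ TensorProduct.map ψ η ∘ₗ R ∘ₗ TensorProduct.mk k H U g)
        (LinearMap.mulLeft k (mulTwisted η h) ∘ₗ α) ∘ₗ (antipode k).lTensor U)
    (fun a b => LinearMap.mulRight k (α (antipode k b)) ∘ₗ LinearMap.mul' k B ∘ₗ
      TensorProduct.map (f ∘ₗ (Smash.of R).toLinearMap ∘ₗ TensorProduct.mk k U H a)
        (η ∘ₗ antipode k)) ?_ ?_).trans rfl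
  · intro a b c d
    simp [pairMap_antipode R hc, mul_assoc]
  · intro a b
    have h1 : ∀ Y : H ⊗[k] H, LinearMap.mul' k B (TensorProduct.map
        (f ∘ₗ (Smash.of R).toLinearMap ∘ₗ TensorProduct.mk k U H a) (η ∘ₗ antipode k) Y) =
        LinearMap.mul' k B (TensorProduct.map ψ (mulPair η ∘ₗ
          LinearMap.mulRight k ((antipode k).lTensor H Y) ∘ₗ (tinl k H).toLinearMap)
            (R (g ⊗ₜ a))) := by
      intro Y
      induction Y with
      | zero =>
        rw [map_zero, map_zero, map_zero, LinearMap.mulRight_zero_eq_zero, LinearMap.zero_comp,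
          LinearMap.comp_zero, TensorProduct.map_zero_right, LinearMap.zero_apply, map_zero]
      | add a b ha hb =>
        have : ∀ a b : H ⊗[k] H, LinearMap.mulRight k (a + b) =
            LinearMap.mulRight k a + LinearMap.mulRight k b := by
          intro a b
          ext; simp [mul_add]
        rw [map_add, map_add, ha, hb, map_add, this, LinearMap.add_comp, LinearMap.comp_add,
          TensorProduct.map_add_right, LinearMap.add_apply, map_add]
      | tmul c d =>
        simp only [map_tmul, LinearMap.comp_apply, LinearEquiv.coe_coe, mk_apply, hf,
          LinearMap.mul'_apply]
        induction R (g ⊗ₜ a) with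
        | zero => simp
        | add a b ha hb => simp only [map_add, add_mul, ha, hb]
        | tmul p q => simp [mulPair_tmul, mul_assoc]
    simp only [LinearMap.comp_apply, LinearMap.mulRight_apply, h1, LinearMap.lTensor_tmul,
      map_tmul, LinearMap.mul'_apply, LinearMap.mulLeft_apply, mk_apply]
    rw [← LinearMap.comp_apply ((antipode k).lTensor H) comul, ← twistedComul]
    induction R (g ⊗ₜ a) with
    | zero => simp
    | add a b ha hb => simp only [map_add, add_mul, ha, hb]
    | tmul p q => simp [mulPair_mul_twistedComul_eq hη, mul_assoc]

include hα hη hc in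
-- Everything is reduced to α(u₁) e_h α(S u₂). The axioms for η are spent inside e_h; those for α
-- apply after e_h has been moved out of the way.
theorem isPartialRep_pairMap : IsPartialRep (pairMap R α η) := by
  have hπ : ∀ u h, LinearMap.mul' k B (TensorProduct.map (pairMap R α η)
        (pairMap R α η ∘ₗ antipode k) (comul (R := k) (Smash.of R (u ⊗ₜ h)))) =
      LinearMap.mul' k B (TensorProduct.map α
        (LinearMap.mulLeft k (mulTwisted η h) ∘ₗ α) (twistedComul k U u)) := by
    intro u h
    rw [sum_pairMap_antipode R hη hc α 1 _ (fun a c => by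
      rw [pairMap_of, IsNormal.right]; simp)]
    congr 3
    ext a
    simp [IsNormal.right, hη.map_one]
  refine ⟨?_, fun x a => ?_, fun a x => ?_⟩
  · rw [Smash.one_def, pairMap_of]
    simp [hα.map_one, hη.map_one]
  · obtain ⟨x, rfl⟩ := (Smash.of R).surjective x
    obtain ⟨a, rfl⟩ := (Smash.of R).surjective a
    induction x with
    | zero =>
      rw [map_zero, map_zero, zero_mul, LinearMap.mulLeft_zero_eq_zero,
        LinearMap.comp_zero, TensorProduct.map_zero_left, LinearMap.zero_apply, map_zero]
    | add x y hx hy =>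
      have : ∀ a b : Smash R, LinearMap.mulLeft k (a + b) =
          LinearMap.mulLeft k a + LinearMap.mulLeft k b := by
        intro a b
        ext z
        simp [add_mul]
      rw [map_add, map_add, add_mul, hx, hy, this, LinearMap.comp_add,
        TensorProduct.map_add_left, LinearMap.add_apply, map_add]
    | tmul v g =>
    induction a with
    | zero => simp
    | add x y hx hy => simp only [map_add, mul_add, hx, hy]
    | tmul u h =>
    rw [hπ, sum_pairMap_antipode R hη hc (α ∘ₗ LinearMap.mulLeft k v) g _
      (fun a c => pairMap_mul R α η v g a c)]
    rw [← LinearMap.comp_apply (LinearMap.mul' k B) (TensorProduct.map (_ ∘ₗ _ ∘ₗ _) _),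
      sum_mul_mulTwisted_mul R hc (α ∘ₗ LinearMap.mulLeft k v) g h u _ (fun a b => by simp)]
    -- Compatibility rewrites η(g)α(a) in crossed form, so this side is also covered by
    -- `sum_mul_mulTwisted_mul`, now with ψ = α. The two sides then differ only in whether v stands
    -- inside α.
    have h1 : ∀ w : U ⊗[k] U, pairMap R α η (Smash.of R (v ⊗ₜ g)) * LinearMap.mul' k B
        (TensorProduct.map α (LinearMap.mulLeft k (mulTwisted η h) ∘ₗ α) w) =
        α v * LinearMap.mul' k B (TensorProduct.map
          (LinearMap.mul' k B ∘ₗ TensorProduct.map α η ∘ₗ R ∘ₗ TensorProduct.mk k H U g)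
          (LinearMap.mulLeft k (mulTwisted η h) ∘ₗ α) w) := by
      intro w
      induction w with
      | zero => simp
      | add a b ha hb => simp only [map_add, mul_add, ha, hb]
      | tmul a b =>
        simp only [pairMap_of, map_tmul, LinearMap.mul'_apply, LinearMap.comp_apply, mk_apply,
          ← hc, mul_assoc]
    rw [h1, ← LinearMap.comp_apply (LinearMap.mul' k B) (TensorProduct.map (_ ∘ₗ _ ∘ₗ _) _),
      sum_mul_mulTwisted_mul R hc α g h u _ (fun a b => by simp)]
    induction comul (R := k) u with
    | zero => simp
    | add a b ha hb => simp only [map_add, mul_add, ha, hb]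
    | tmul a b =>
      simp only [map_tmul, LinearMap.mul'_apply, LinearMap.comp_apply (twoPassMap R _ _ _ _),
        ← mul_twoPassMap_twistedComul R hα, mul_assoc]
  · obtain ⟨x, rfl⟩ := (Smash.of R).surjective x
    obtain ⟨a, rfl⟩ := (Smash.of R).surjective a
    induction x with
    | zero =>
      rw [map_zero, map_zero, mul_zero, LinearMap.mulRight_zero_eq_zero, LinearMap.zero_comp,
        LinearMap.comp_zero, TensorProduct.map_zero_right, LinearMap.zero_apply, map_zero]
    | add x y hx hy =>
      have : ∀ a b : Smash R, LinearMap.mulRight k (a + b) =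
          LinearMap.mulRight k a + LinearMap.mulRight k b := by
        intro a b
        ext z
        simp [mul_add]
      rw [map_add, map_add, mul_add, hx, hy, this, LinearMap.add_comp, LinearMap.comp_add,
        TensorProduct.map_add_right, LinearMap.add_apply, map_add]
    | tmul v g =>
    induction a with
    | zero => simp
    | add x y hx hy => simp only [map_add, add_mul, hx, hy]
    | tmul u h =>
    rw [hπ]
    let G : U ⊗[k] U →ₗ[k] B := LinearMap.mul' k B ∘ₗ TensorProduct.map α
      (LinearMap.mulLeft k (mulTwisted η h) ∘ₗ α ∘ₗ LinearMap.mulRight k v)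
    -- The sum over Δ(h) recombines η(h₁) with the crossing of S(h₂) and S(u₂)v into e_h α(S(u₂)v)
    -- η(g), by `sum_mul_map_eq`.
    have h1 : LinearMap.mul' k B (TensorProduct.map (pairMap R α η)
        (pairMap R α η ∘ₗ LinearMap.mulRight k (Smash.of R (v ⊗ₜ g)) ∘ₗ antipode k)
        (comul (R := k) (Smash.of R (u ⊗ₜ h)))) = G (twistedComul k U u) * η g := by
      refine (mul'_map_comul_of R u h _ _ (LinearMap.mulRight k (η g) ∘ₗ G ∘ₗ
          (antipode k).lTensor U)
        (fun a b => LinearMap.mulLeft k (α a) ∘ₗ LinearMap.mul' k B ∘ₗ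
          TensorProduct.map η (LinearMap.mul' k B ∘ₗ
            TensorProduct.map α (η ∘ₗ LinearMap.mulRight k g) ∘ₗ R ∘ₗ
            (TensorProduct.mk k H U).flip (antipode k b * v)) ∘ₗ (antipode k).lTensor H)
          ?_ ?_).trans rfl
      · intro a b c d
        simp only [LinearMap.comp_apply, LinearMap.mulRight_apply, pairMap_antipode_mul,
          pairMap_of, map_tmul, LinearMap.lTensor_tmul, LinearMap.mul'_apply,
          LinearMap.mulLeft_apply, LinearMap.flip_apply, mk_apply, mul_assoc]
      · intro a b
        have h2 := sum_mul_map_eq R hη hc h g (antipode k b * v) (LinearMap.mul' k B ∘ₗ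
          TensorProduct.map η (LinearMap.mul' k B ∘ₗ
            TensorProduct.map α (η ∘ₗ LinearMap.mulRight k g) ∘ₗ R ∘ₗ
            (TensorProduct.mk k H U).flip (antipode k b * v))) (fun c d => by simp)
        change _ = α a * _
        refine Eq.trans ?_ (congrArg (α a * ·) h2).symm
        simp [G, mul_assoc]
    rw [h1, ← sum_mulTwisted_mul_mul R hα hc h u v (LinearMap.mulRight k (α v) ∘ₗ
      LinearMap.mul' k B ∘ₗ TensorProduct.map α (LinearMap.mulLeft k (mulTwisted η h) ∘ₗ α)) G
      (fun a b => by simp) (fun a b => by simp [G]), pairMap_of]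
    simp [mul_assoc]

end PairMap

end PartialHopf

namespace PartialHopf

/-! ### Restricting partial representations along Hopf algebra maps. -/

section Restriction

open Coalgebra HopfAlgebra

variable {k : Type*} [Field k]

/-- Such an f carries a₁ ⊗ S(a₂) to f(a)₁ ⊗ S(f(a)₂), so the axioms at f(h) and f(a) are those for
the composite. -/
theorem IsPartialRep.comp_hopf {A C : Type*} [Ring A] [HopfAlgebra k A] [Ring C] [HopfAlgebra k C]
    {B : Type*} [Ring B] [Algebra k B] {π : C →ₗ[k] B} (hπ : IsPartialRep π) (f : A →ₐ[k] C)
    (hΔ : ∀ a, comul (R := k) (f a) =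
      TensorProduct.map f.toLinearMap f.toLinearMap (comul (R := k) a))
    (hS : ∀ a, antipode k (f a) = f (antipode k a)) : IsPartialRep (π ∘ₗ f.toLinearMap) := by
  have hπ' := isPartialRep_iff.mp hπ
  have hD : ∀ a, twistedComul k C (f a) =
      TensorProduct.map f.toLinearMap f.toLinearMap (twistedComul k A a) := by
    intro a
    rw [twistedComul, LinearMap.comp_apply, hΔ, twistedComul, LinearMap.comp_apply]
    induction comul (R := k) a with
    | zero => simp
    | add a b ha hb => simp only [map_add, ha, hb]
    | tmul a b => simp [hS]
  have hm : ∀ z : A ⊗[k] A, mulPair (π ∘ₗ f.toLinearMap) z =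
      mulPair π (TensorProduct.map f.toLinearMap f.toLinearMap z) := by
    intro z
    induction z with
    | zero => simp
    | add a b ha hb => simp only [map_add, ha, hb]
    | tmul a b => simp [mulPair_tmul]
  have hmul : ∀ z w : A ⊗[k] A, TensorProduct.map f.toLinearMap f.toLinearMap (z * w) =
      TensorProduct.map f.toLinearMap f.toLinearMap z *
        TensorProduct.map f.toLinearMap f.toLinearMap w :=
    map_mul (Algebra.TensorProduct.map f f)
  refine isPartialRep_iff.mpr ⟨?_, fun h a => ?_, fun a h => ?_⟩
  · simp [hπ'.1]
  · have := hπ'.2.1 (f h) (f a)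
    rw [hm, hm, hmul, ← hD]
    simpa using this
  · have := hπ'.2.2 (f a) (f h)
    rw [hm, hm, hmul, ← hD]
    simpa using this

variable {U : Type*} [Ring U] [HopfAlgebra k U] {H : Type*} [Ring H] [HopfAlgebra k H]
  (R : H ⊗[k] U →ₗ[k] U ⊗[k] H) [IsNormal R] [IsMultiplicative R] [IsCoalgMap R]

theorem Smash.comul_inclLeft (u : U) : comul (R := k) (Smash.inclLeft R u) =
    TensorProduct.map (Smash.inclLeft R).toLinearMap (Smash.inclLeft R).toLinearMap
      (comul (R := k) u) := by
  change comul (R := k) (Smash.of R (u ⊗ₜ 1)) = _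
  rw [Smash.comul_of, TensorProduct.comul_tmul, Bialgebra.comul_one,
    Algebra.TensorProduct.one_def]
  induction comul (R := k) u with
  | zero => simp
  | add a b ha hb => simp only [add_tmul, map_add, ha, hb]
  | tmul a b => rfl

theorem Smash.comul_inclRight (h : H) : comul (R := k) (Smash.inclRight R h) =
    TensorProduct.map (Smash.inclRight R).toLinearMap (Smash.inclRight R).toLinearMap
      (comul (R := k) h) := by
  change comul (R := k) (Smash.of R (1 ⊗ₜ h)) = _
  rw [Smash.comul_of, TensorProduct.comul_tmul, Bialgebra.comul_one,
    Algebra.TensorProduct.one_def]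
  induction comul (R := k) h with
  | zero => simp
  | add a b ha hb => simp only [tmul_add, map_add, ha, hb]
  | tmul a b => rfl

theorem Smash.antipode_inclLeft (u : U) :
    antipode k (Smash.inclLeft R u) = Smash.inclLeft R (antipode k u) := by
  change smashAntipode R (Smash.of R (u ⊗ₜ 1)) = _
  rw [smashAntipode_of, antipode_one, map_one, one_mul]

theorem Smash.antipode_inclRight (h : H) :
    antipode k (Smash.inclRight R h) = Smash.inclRight R (antipode k h) := by
  change smashAntipode R (Smash.of R (1 ⊗ₜ h)) = _
  rw [smashAntipode_of, antipode_one, map_one, mul_one]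

end Restriction

/-! ### Universal property of the twisted product. -/

section Universal

variable {k : Type*} [Field k]
  {U : Type*} [Ring U] [HopfAlgebra k U] {H : Type*} [Ring H] [HopfAlgebra k H]
  (R : H ⊗[k] U →ₗ[k] U ⊗[k] H) [IsNormal R] [IsMultiplicative R] [IsCoalgMap R]
  {B : Type*} [Ring B] [Algebra k B] {α : U →ₗ[k] B} {η : H →ₗ[k] B}

/-- Compatibility propagates from letters to words in the order in which the twist was built: first
one letter of H against a word in U_par, then a word in H_par. -/
theorem lift_mul_lift (hα : IsPartialRep α) (hη : IsPartialRep η)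
    (hc : ∀ u h, η h * α u = LinearMap.mul' k B (TensorProduct.map α η (R (h ⊗ₜ[k] u))))
    (y : Par k H) (t : Par k U) : Par.lift η hη y * Par.lift α hα t = LinearMap.mul' k B
      (TensorProduct.map (Par.lift α hα).toLinearMap (Par.lift η hη).toLinearMap
        (parTwist R (y ⊗ₜ t))) := by
  have h1 : ∀ (h : H) (t : Par k U), η h * Par.lift α hα t = LinearMap.mul' k B
      (TensorProduct.map (Par.lift α hα).toLinearMap η (parPass R (h ⊗ₜ t))) := by
    intro h t
    induction t using Par.induction generalizing h with
    | hι u =>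
      rw [Par.lift_ι, hc, parPass_ι]
      induction R (h ⊗ₜ u) with
      | zero => simp
      | add a b ha hb => simp only [map_add, ha, hb]
      | tmul p q => simp [Par.lift_ι]
    | halg c =>
      rw [parPass_algebraMap, AlgHom.commutes]
      simp [Algebra.algebraMap_eq_smul_one]
    | hmul x y hx hy =>
      rw [map_mul, ← mul_assoc, hx, parPass_mul]
      induction parPass R (h ⊗ₜ x) with
      | zero => simp
      | add a b ha hb => simp only [map_add, add_mul, ha, hb]
      | tmul p q =>
      rw [map_tmul, LinearMap.mul'_apply, mul_assoc, hy, opr_tmul]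
      induction parPass R (q ⊗ₜ y) with
      | zero => simp
      | add a b ha hb => simp only [map_add, mul_add, ha, hb]
      | tmul p q => simp [mul_assoc]
    | hadd x y hx hy => simp only [tmul_add, map_add, mul_add, hx, hy]
  induction y using Par.induction generalizing t with
  | hι h =>
    rw [Par.lift_ι, h1, parTwist_ι_tmul]
    induction parPass R (h ⊗ₜ t) with
    | zero => simp
    | add a b ha hb => simp only [map_add, ha, hb]
    | tmul p q => simp [Par.lift_ι]
  | halg c =>
    rw [parTwist_algebraMap, AlgHom.commutes]
    simp [Algebra.algebraMap_eq_smul_one]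
  | hmul x y hx hy =>
    rw [map_mul, mul_assoc, hy, parTwist_mul_tmul]
    induction parTwist R (y ⊗ₜ t) with
    | zero => simp
    | add a b ha hb => simp only [map_add, mul_add, ha, hb]
    | tmul p q =>
    rw [map_tmul, LinearMap.mul'_apply, AlgHom.toLinearMap_apply, AlgHom.toLinearMap_apply,
      ← mul_assoc, hx, opl_tmul]
    induction parTwist R (x ⊗ₜ p) with
    | zero => simp
    | add a b ha hb => simp only [map_add, add_mul, ha, hb]
    | tmul p q => simp [mul_assoc]
  | hadd x y hx hy => simp only [add_tmul, map_add, add_mul, hx, hy]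

section Lift

variable {P Q : Type*} [Ring P] [Algebra k P] [Ring Q] [Algebra k Q]
  (T : Q ⊗[k] P →ₗ[k] P ⊗[k] Q) [IsNormal T] [IsMultiplicative T]

/-- The algebra map on `P #_T Q` given by compatible algebra maps on `P` and `Q`. -/
noncomputable def Smash.lift (f : P →ₐ[k] B) (g : Q →ₐ[k] B)
    (hc : ∀ q p, g q * f p =
      LinearMap.mul' k B (TensorProduct.map f.toLinearMap g.toLinearMap (T (q ⊗ₜ p)))) :
    Smash T →ₐ[k] B :=
  AlgHom.ofLinearMap (LinearMap.mul' k B ∘ₗ TensorProduct.map f.toLinearMap g.toLinearMap ∘ₗ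
      (Smash.of T).symm.toLinearMap)
    (by rw [Smash.one_def]; simp)
    (fun x y => by
      obtain ⟨x, rfl⟩ := (Smash.of T).surjective x
      obtain ⟨y, rfl⟩ := (Smash.of T).surjective y
      simp only [LinearMap.comp_apply, LinearEquiv.coe_coe, LinearEquiv.symm_apply_apply]
      induction x with
      | zero => simp
      | add a b ha hb => simp only [map_add, add_mul, ha, hb]
      | tmul p q =>
      induction y with
      | zero => simp
      | add a b ha hb => simp only [map_add, mul_add, ha, hb]
      | tmul p' q' =>
      change LinearMap.mul' k B (TensorProduct.map _ _
        ((Smash.of T).symm (Smash.mk T p q * Smash.mk T p' q'))) = _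
      rw [Smash.mk_mul_mk, LinearEquiv.symm_apply_apply, map_tmul, map_tmul, LinearMap.mul'_apply,
        LinearMap.mul'_apply, mul_assoc, ← mul_assoc (g.toLinearMap q)]
      simp only [AlgHom.toLinearMap_apply, hc]
      induction T (q ⊗ₜ p') with
      | zero => simp
      | add a b ha hb => simp only [map_add, mul_add, add_mul, ha, hb]
      | tmul a b => simp [mul_assoc])

theorem Smash.lift_mk (f : P →ₐ[k] B) (g : Q →ₐ[k] B)
    (hc : ∀ q p, g q * f p =
      LinearMap.mul' k B (TensorProduct.map f.toLinearMap g.toLinearMap (T (q ⊗ₜ p)))) (p : P)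
    (q : Q) : Smash.lift T f g hc (Smash.mk T p q) = f p * g q := by
  simp [Smash.lift, Smash.mk]

/-- The inclusion `P → P #_T Q`. -/
noncomputable def Smash.left : P →ₐ[k] Smash T :=
  AlgHom.ofLinearMap ((Smash.of T).toLinearMap ∘ₗ (TensorProduct.mk k P Q).flip 1) rfl
    (fun p p' => by
      change _ = Smash.mk T p 1 * Smash.mk T p' 1
      rw [Smash.mk_mul_mk, IsNormal.right]
      simp)

/-- The inclusion `Q → P #_T Q`. -/
noncomputable def Smash.right : Q →ₐ[k] Smash T :=
  AlgHom.ofLinearMap ((Smash.of T).toLinearMap ∘ₗ TensorProduct.mk k P Q 1) rfl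
    (fun q q' => by
      change _ = Smash.mk T 1 q * Smash.mk T 1 q'
      rw [Smash.mk_mul_mk, IsNormal.left]
      simp)

theorem Smash.left_apply (p : P) : Smash.left T p = Smash.mk T p 1 := rfl

theorem Smash.right_apply (q : Q) : Smash.right T q = Smash.mk T 1 q := rfl

theorem Smash.left_mul_right (p : P) (q : Q) :
    Smash.left T p * Smash.right T q = Smash.mk T p q := by
  rw [Smash.left_apply, Smash.right_apply, Smash.mk_mul_mk, IsNormal.right]
  simp [Smash.mk]

theorem Smash.right_mul_left (p : P) (q : Q) :
    Smash.right T q * Smash.left T p = Smash.of T (T (q ⊗ₜ p)) := by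
  rw [Smash.left_apply, Smash.right_apply, Smash.mk_mul_mk]
  simp

theorem Smash.algHom_ext {f g : Smash T →ₐ[k] B} (hl : ∀ p, f (Smash.left T p) = g (Smash.left T p))
    (hr : ∀ q, f (Smash.right T q) = g (Smash.right T q)) : f = g := by
  ext x
  obtain ⟨x, rfl⟩ := (Smash.of T).surjective x
  induction x with
  | zero => simp
  | add a b ha hb => simp only [map_add, ha, hb]
  | tmul p q =>
    change f (Smash.mk T p q) = g (Smash.mk T p q)
    rw [← Smash.left_mul_right, map_mul, map_mul, hl, hr]

end Lift

end Universal

/-! ### The isomorphisms of categories. -/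

section Isomorphisms

variable {k : Type*} [Field k]
  {U : Type*} [Ring U] [HopfAlgebra k U] {H : Type*} [Ring H] [HopfAlgebra k H]
  (R : H ⊗[k] U →ₗ[k] U ⊗[k] H) [IsNormal R] [IsMultiplicative R] [IsCoalgMap R]

/-- The split partial representation `u # h ↦ α(u) η(h)`. -/
noncomputable def CompatiblePair.toSplit (X : CompatiblePair.{w} R) : SplitPartialRep.{w} R where
  alg := X.alg
  π := pairMap R X.α X.η
  isPartialRep := isPartialRep_pairMap R X.isPartialRep_α X.isPartialRep_η X.compat
  split_left u h := by
    rw [pairMap_mk, pairMap_mk, pairMap_mk, X.isPartialRep_α.map_one, X.isPartialRep_η.map_one,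
      mul_one, one_mul]
  split_right u h := by
    rw [pairMap_of, pairMap_mk, pairMap_mk, X.isPartialRep_α.map_one, X.isPartialRep_η.map_one,
      mul_one, one_mul, X.compat]

/-- The restrictions of a split partial representation to `U` and `H`. -/
noncomputable def SplitPartialRep.toPair (X : SplitPartialRep.{w} R) : CompatiblePair.{w} R where
  alg := X.alg
  α := X.π ∘ₗ (Smash.inclLeft R).toLinearMap
  η := X.π ∘ₗ (Smash.inclRight R).toLinearMap
  isPartialRep_α := X.isPartialRep.comp_hopf _ (Smash.comul_inclLeft R) (Smash.antipode_inclLeft R)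
  isPartialRep_η :=
    X.isPartialRep.comp_hopf _ (Smash.comul_inclRight R) (Smash.antipode_inclRight R)
  compat u h := by
    refine (X.split_right u h).symm.trans ?_
    induction R (h ⊗ₜ u) with
    | zero => simp
    | add a b ha hb => simp only [map_add, ha, hb]
    | tmul a b => exact X.split_left a b

theorem CompatiblePair.pairMap_inclLeft (X : CompatiblePair.{w} R) :
    pairMap R X.α X.η ∘ₗ (Smash.inclLeft R).toLinearMap = X.α := by
  ext u
  change pairMap R X.α X.η (Smash.mk R u 1) = _
  rw [pairMap_mk, X.isPartialRep_η.map_one, mul_one]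

theorem CompatiblePair.pairMap_inclRight (X : CompatiblePair.{w} R) :
    pairMap R X.α X.η ∘ₗ (Smash.inclRight R).toLinearMap = X.η := by
  ext h
  change pairMap R X.α X.η (Smash.mk R 1 h) = _
  rw [pairMap_mk, X.isPartialRep_α.map_one, one_mul]

theorem SplitPartialRep.pairMap_incl (X : SplitPartialRep.{w} R) :
    pairMap R (X.π ∘ₗ (Smash.inclLeft R).toLinearMap)
      (X.π ∘ₗ (Smash.inclRight R).toLinearMap) = X.π := by
  ext x
  obtain ⟨x, rfl⟩ := (Smash.of R).surjective x
  induction x with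
  | zero => simp
  | add a b ha hb => simp only [map_add, ha, hb]
  | tmul u h => exact (pairMap_mk R _ _ u h).trans (X.split_left u h).symm

/-- An isomorphism of categories demands equality of objects. With the target algebra held fixed
this reduces to equality of the structure maps, with no transport between algebras; likewise for the
two analogues below. -/
theorem CompatiblePair.mk_congr (X : CompatiblePair.{w} R) {α : U →ₗ[k] X.alg} {η : H →ₗ[k] X.alg}
    (hα hη hc) (eα : α = X.α) (eη : η = X.η) : CompatiblePair.mk X.alg α η hα hη hc = X := by
  subst eα eη
  rfl

theorem SplitPartialRep.mk_congr (X : SplitPartialRep.{w} R) {π : Smash R →ₗ[k] X.alg}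
    (hπ hl hr) (e : π = X.π) : SplitPartialRep.mk X.alg π hπ hl hr = X := by
  subst e
  rfl

theorem AlgRep.mk_congr {A : Type*} [Ring A] [Algebra k A] (X : AlgRep.{w} k A) {σ : A →ₐ[k] X.alg}
    (e : σ = X.σ) : AlgRep.mk X.alg σ = X := by
  subst e
  rfl

theorem algHom_comp_pairMap {B B' : Type*} [Ring B] [Algebra k B] [Ring B'] [Algebra k B']
    (f : B →ₐ[k] B') (α : U →ₗ[k] B) (η : H →ₗ[k] B) :
    f.toLinearMap ∘ₗ pairMap R α η = pairMap R (f.toLinearMap ∘ₗ α) (f.toLinearMap ∘ₗ η) := by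
  ext x
  obtain ⟨x, rfl⟩ := (Smash.of R).surjective x
  rw [LinearMap.comp_apply, pairMap_of, pairMap_of, AlgHom.toLinearMap_apply, algHom_mul'_map]

/-- The functor from compatible pairs to split partial representations. -/
noncomputable def pairToSplit : CompatiblePair.{w} R ⥤ SplitPartialRep.{w} R where
  obj X := X.toSplit R
  map {X Y} f := ⟨CompatiblePair.Hom.algHom f,
    (algHom_comp_pairMap R (CompatiblePair.Hom.algHom f) X.α X.η).trans
      (congrArg₂ (pairMap R) (CompatiblePair.Hom.comp_α f) (CompatiblePair.Hom.comp_η f))⟩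

/-- The functor keeps the underlying algebra map, whence faithfulness. It is full because α and η
are recovered from π by restriction. -/
instance isIso_pairToSplit : (pairToSplit.{w} R).IsIso where
  faithful := ⟨fun {X Y f g} h =>
    CompatiblePair.Hom.ext (congrArg SplitPartialRep.Hom.algHom h)⟩
  full := ⟨fun {X Y} g => ⟨⟨SplitPartialRep.Hom.algHom g, by
      rw [← X.pairMap_inclLeft, ← Y.pairMap_inclLeft, ← LinearMap.comp_assoc]
      exact congrArg (· ∘ₗ _) (SplitPartialRep.Hom.comp_π g), by
      rw [← X.pairMap_inclRight, ← Y.pairMap_inclRight, ← LinearMap.comp_assoc]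
      exact congrArg (· ∘ₗ _) (SplitPartialRep.Hom.comp_π g)⟩, rfl⟩⟩
  bijective_obj := Function.bijective_iff_has_inverse.mpr ⟨fun X => X.toPair R,
    fun X => X.mk_congr R _ _ _ (X.pairMap_inclLeft R) (X.pairMap_inclRight R),
    fun X => X.mk_congr R _ _ _ (X.pairMap_incl R)⟩

/-- The algebra map `U_par # H_par → B` given by a compatible pair. -/
noncomputable def CompatiblePair.toAlgRep (X : CompatiblePair.{w} R) :
    AlgRep.{w} k (Smash (parTwist R)) where
  alg := X.alg
  σ := Smash.lift (parTwist R) (Par.lift X.α X.isPartialRep_α) (Par.lift X.η X.isPartialRep_η)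
    (lift_mul_lift R X.isPartialRep_α X.isPartialRep_η X.compat)

/-- The compatible pair given by an algebra map `U_par # H_par → B`. -/
noncomputable def AlgRep.toPair (X : AlgRep.{w} k (Smash (parTwist R))) : CompatiblePair.{w} R where
  alg := X.alg
  α := (X.σ.comp (Smash.left (parTwist R))).toLinearMap ∘ₗ Par.ι k U
  η := (X.σ.comp (Smash.right (parTwist R))).toLinearMap ∘ₗ Par.ι k H
  isPartialRep_α := (Par.isPartialRep_ι k U).algHom_comp _
  isPartialRep_η := (Par.isPartialRep_ι k H).algHom_comp _
  compat u h := by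
    simp only [LinearMap.comp_apply, AlgHom.toLinearMap_apply, AlgHom.comp_apply]
    rw [← map_mul, Smash.right_mul_left, parTwist_ι_tmul_ι]
    induction R (h ⊗ₜ u) with
    | zero => simp
    | add a b ha hb => simp only [map_add, ha, hb]
    | tmul a b =>
      simp only [map_tmul, LinearMap.mul'_apply, LinearMap.comp_apply, AlgHom.toLinearMap_apply,
        AlgHom.comp_apply]
      rw [← map_mul, Smash.left_mul_right]
      rfl

theorem CompatiblePair.toAlgRep_left (X : CompatiblePair.{w} R) (u : U) :
    (X.toAlgRep R).σ (Smash.left (parTwist R) (Par.ι k U u)) = X.α u :=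
  (Smash.lift_mk (parTwist R) _ _
    (lift_mul_lift R X.isPartialRep_α X.isPartialRep_η X.compat) _ _).trans
    (by rw [map_one, mul_one, Par.lift_ι])

theorem CompatiblePair.toAlgRep_right (X : CompatiblePair.{w} R) (h : H) :
    (X.toAlgRep R).σ (Smash.right (parTwist R) (Par.ι k H h)) = X.η h :=
  (Smash.lift_mk (parTwist R) _ _
    (lift_mul_lift R X.isPartialRep_α X.isPartialRep_η X.compat) _ _).trans
    (by rw [map_one, one_mul, Par.lift_ι])

theorem smash_parTwist_algHom_ext {B : Type*} [Ring B] [Algebra k B]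
    {f g : Smash (parTwist R) →ₐ[k] B}
    (hl : ∀ u, f (Smash.left _ (Par.ι k U u)) = g (Smash.left _ (Par.ι k U u)))
    (hr : ∀ h, f (Smash.right _ (Par.ι k H h)) = g (Smash.right _ (Par.ι k H h))) : f = g := by
  refine Smash.algHom_ext _ (AlgHom.congr_fun (φ₁ := f.comp (Smash.left _))
    (φ₂ := g.comp (Smash.left _)) (Par.algHom_ext (LinearMap.ext hl)))
    (AlgHom.congr_fun (φ₁ := f.comp (Smash.right _)) (φ₂ := g.comp (Smash.right _))
      (Par.algHom_ext (LinearMap.ext hr)))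

/-- The functor from compatible pairs to representations of `U_par # H_par`. -/
noncomputable def pairToAlgRep : CompatiblePair.{w} R ⥤ AlgRep.{w} k (Smash (parTwist R)) where
  obj X := X.toAlgRep R
  map {X Y} f := ⟨CompatiblePair.Hom.algHom f,
    smash_parTwist_algHom_ext R
      (fun u => (congrArg (CompatiblePair.Hom.algHom f) (X.toAlgRep_left R u)).trans
        ((LinearMap.congr_fun (CompatiblePair.Hom.comp_α f) u).trans (Y.toAlgRep_left R u).symm))
      (fun h => (congrArg (CompatiblePair.Hom.algHom f) (X.toAlgRep_right R h)).trans
        ((LinearMap.congr_fun (CompatiblePair.Hom.comp_η f) h).trans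
          (Y.toAlgRep_right R h).symm))⟩

instance isIso_pairToAlgRep : (pairToAlgRep.{w} R).IsIso where
  faithful := ⟨fun {X Y f g} h => CompatiblePair.Hom.ext (congrArg AlgRep.Hom.algHom h)⟩
  full := ⟨fun {X Y} g => ⟨⟨AlgRep.Hom.algHom g, by
      ext u
      refine (congrArg (AlgRep.Hom.algHom g) (X.toAlgRep_left R u).symm).trans ?_
      exact (AlgHom.congr_fun (AlgRep.Hom.comp_σ g) _).trans (Y.toAlgRep_left R u), by
      ext h
      refine (congrArg (AlgRep.Hom.algHom g) (X.toAlgRep_right R h).symm).trans ?_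
      exact (AlgHom.congr_fun (AlgRep.Hom.comp_σ g) _).trans (Y.toAlgRep_right R h)⟩, rfl⟩⟩
  bijective_obj := Function.bijective_iff_has_inverse.mpr ⟨fun X => X.toPair R,
    fun X => X.mk_congr R _ _ _ (LinearMap.ext (X.toAlgRep_left R))
      (LinearMap.ext (X.toAlgRep_right R)),
    fun X => X.mk_congr (smash_parTwist_algHom_ext R ((X.toPair R).toAlgRep_left R)
      ((X.toPair R).toAlgRep_right R))⟩

end Isomorphisms

end PartialHopf

theorem theorem3p11 {k : Type*} [Field k]
    {U : Type*} [Ring U] [HopfAlgebra k U] {H : Type*} [Ring H] [HopfAlgebra k H]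
    (hU : Function.Bijective (HopfAlgebra.antipode k : U →ₗ[k] U))
    (hH : Function.Bijective (HopfAlgebra.antipode k : H →ₗ[k] H))
    (R : H ⊗[k] U →ₗ[k] U ⊗[k] H) [IsNormal R] [IsMultiplicative R] [IsCoalgMap R] :
    ∃ (T : Par k H ⊗[k] Par k U →ₗ[k] Par k U ⊗[k] Par k H)
      (_ : IsNormal T) (_ : IsMultiplicative T),
      IsInducedTwist R T ∧
      (∃ e : IsoCat (CompatiblePair.{w} R) (SplitPartialRep.{w} R),
        e.functor ⋙ SplitPartialRep.target = CompatiblePair.target) ∧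
      (∃ e : IsoCat (SplitPartialRep.{w} R) (AlgRep.{w} k (Smash T)),
        e.functor ⋙ AlgRep.target = SplitPartialRep.target) := by
  let e₁ := (pairToSplit.{w} R).asIsomorphism
  let e₂ := (pairToAlgRep.{w} R).asIsomorphism
  have h₁ : e₁.functor ⋙ SplitPartialRep.target = CompatiblePair.target := rfl
  have h₂ : e₂.functor ⋙ AlgRep.target = CompatiblePair.target := rfl
  refine ⟨parTwist R, inferInstance, inferInstance, isInducedTwist_parTwist R, ⟨e₁, h₁⟩,
    ⟨e₁.symm.trans e₂, ?_⟩⟩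
  -- The second isomorphism passes through compatible pairs. Both functors out of that category
  -- preserve targets on the nose, and the strict counit equation of `e₁` transports this to its
  -- inverse.
  change e₁.inverse ⋙ (e₂.functor ⋙ AlgRep.target) = _
  rw [h₂, ← h₁, ← Functor.assoc, e₁.counit_eq, Functor.id_comp]
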